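/- An integral domain $S$ is *N-1* if its integral closure in its fraction field is a finite $S$-module, and *N-2* (or *Japanese*) if its integral closure in every finite extension of its fraction field is a finite $S$-module. A ring $R$ is *universally Japanese* if every finite type $R$-algebra that is an integral domain is N-1. Let $V$ be a discrete valuation ring that is N-2, and let $x$ be a uniformizer of $V$. Inside the field $\operatorname{Frac}(V[Y_0,Y_1,Y_2,\ldots])$ put $x_0=x$ and $x_{i+1}=x_i/Y_i^2$ for $i\ge 0$, and let $R_i=V[x_i,Y_0,\ldots,Y_{i-1}]$ (so $R_i\cong V[X,Y_0,\ldots,Y_{i-1}]/(x-XY_0^2\cdots Y_{i-1}^2)$). Let $D_i$ be the localization of $R_i$ with respect to the complement of $x_iR_i\cup Y_0R_i\cup\cdots\cup Y_{i-1}R_i$, and let $D=\bigcup_i D_i$, the union of this increasing chain. Then $D$ is an integral domain containing $V$ with the following properties. 1. $D$ is not Noetherian. 2. For every maximal ideal $\mathfrak m$ of $D$, the localization $D_{\mathfrak m}$ is a discrete valuation ring that is universally Japanese and dominates $V$ (that is, $V\to D_{\mathfrak m}$ is an injective local homomorphism). 3. $D$ is not N-2. 4. For every integer $n>1$, the ring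 $D[T]/(T^n-x)$ is an integral domain that is not N-1. -/

import Mathlib

universe u

/-- An integral domain `S` is N-1 if its integral closure in its fraction field is a finite
`S`-module. -/
def IsN1 (S : Type u) [CommRing S] [IsDomain S] : Prop :=
  Module.Finite S (integralClosure S (FractionRing S))

/-- An integral domain `S` is N-2 (or Japanese) if its integral closure in every finite extension
`L` of its fraction field is a finite `S`-module. (Every finite extension of the fraction field has
an isomorphic copy in the universe of `S`.) -/
def IsN2 (S : Type u) [CommRing S] [IsDomain S] : Prop :=
  ∀ (L : Type u) [Field L] [Algebra (FractionRing S) L] [Algebra S L]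
    [IsScalarTower S (FractionRing S) L] [FiniteDimensional (FractionRing S) L],
    Module.Finite S (integralClosure S L)

/-- A ring `R` is universally Japanese if every finite type `R`-algebra that is an integral domain
is N-1. (Every finite type `R`-algebra has an isomorphic copy in the universe of `R`.) -/
def IsUniversallyJapanese (R : Type u) [CommRing R] : Prop :=
  ∀ (A : Type u) [CommRing A] [IsDomain A] [Algebra R A] [Algebra.FiniteType R A], IsN1 A

namespace AlmostDedekindExample

variable (V : Type u) [CommRing V] [IsDomain V]

/-- The field of rational functions over `V` in countably many variables `Y₀, Y₁, Y₂, …`, in which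
all the rings of the construction are formed. -/
abbrev Amb : Type u := FractionRing (MvPolynomial ℕ V)

/-- The variable `Yⱼ`, as an element of the ambient field. -/
noncomputable def y (j : ℕ) : Amb V :=
  algebraMap (MvPolynomial ℕ V) (Amb V) (MvPolynomial.X j)

variable {V}

/-- The elements `x₀ = x`, `xᵢ₊₁ = xᵢ / yᵢ²`, so that `xᵢ = xᵢ₊₁ yᵢ²`. -/
noncomputable def xs (x : V) : ℕ → Amb V
  | 0 => algebraMap V (Amb V) x
  | i + 1 => xs x i / y V i ^ 2

/-- The ring `Rᵢ = V[xᵢ, y₀, …, yᵢ₋₁]`. For `x` a uniformizer of a discrete valuation ring `V` it is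
`V[X, Y₀, …, Yᵢ₋₁] / (x - X Y₀² ⋯ Yᵢ₋₁²)`, and `Rᵢ₊₁ = Rᵢ[X, Y] / (xᵢ - X Y²)`. -/
noncomputable def R (x : V) (i : ℕ) : Subalgebra V (Amb V) :=
  Algebra.adjoin V (insert (xs x i) (y V '' Set.Iio i))

/-- The complement in `Rᵢ` of the union of the principal ideals generated by `xᵢ` and by
`y₀, …, yᵢ₋₁`. -/
def denominators (x : V) (i : ℕ) : Set (Amb V) :=
  {b | b ∈ R x i ∧ (∀ r ∈ R x i, b ≠ xs x i * r) ∧ ∀ j < i, ∀ r ∈ R x i, b ≠ y V j * r}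

/-- The ring `Dᵢ`, the localization of `Rᵢ` with respect to `denominators x i`, as the subring of
the ambient field generated by `Rᵢ` and the inverses of the denominators. -/
noncomputable def stage (x : V) (i : ℕ) : Subalgebra V (Amb V) :=
  R x i ⊔ Algebra.adjoin V ((fun b => b⁻¹) '' denominators x i)

/-- The ring `D`, the union of the increasing chain of the rings `Dᵢ` (for a chain of subrings the
supremum is the union). -/
noncomputable def D (x : V) : Subalgebra V (Amb V) := ⨆ i, stage x i

end AlmostDedekindExample

-- The relation `xᵢ = xᵢ₊₁ yᵢ²` says that the prime `xᵢ` of one stage splits at the next stage into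
-- `xᵢ₊₁` and a doubled prime `yᵢ`. In the limit `D` has a place `some j` for every variable, with
-- uniformizer `yⱼ` and `v(x) = 2`, and one limit place `none`, with uniformizer `x`. The maximal
-- ideals of `D` are exactly the centers of these places (`exists_forall_notMem_iff`), and `D`
-- localizes there to the valuation rings.
--
-- Good local rings. At `none` the valuation ring is the Gauss ring, the localization of `V[Y₀, Y₁,
-- …]` at the extension of the maximal ideal of `V`. At `some j` the element `x / yⱼ²` is a unit
-- with transcendental residue; the valuation ring is the Gauss ring in the coordinates where `x /
-- yⱼ²` replaces `Yⱼ`, with the square root `yⱼ` of `x / (x / yⱼ²)` adjoined (`exists_isPlace`). So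
-- it is finite over a Gauss ring. A Noetherian localization of a polynomial ring over an N-2 domain
-- is N-2 (`IsN2.of_isLocalization_mvPolynomial`): separable extensions are handled by the trace
-- form, inseparable ones by extracting `p`-power roots of the finitely many variables and
-- coefficients involved. Finite extensions inherit N-2, and an N-2 discrete valuation ring is
-- universally Japanese (`IsN2.isUniversallyJapanese`), by Noether normalization and Zariski's main
-- theorem.
--
-- Bad global ring. The ideals `(xᵢ)` increase strictly, so `D` is not Noetherian. If `tⁿ = x` with
-- `n ≥ 2`, then `tⁿ⁻¹ / (y₀ ⋯ yᵢ₋₁)` is integral over `D`, because its `n`-th power is `xᵢⁿ⁻¹ (y₀ ⋯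
-- yᵢ₋₁)ⁿ⁻²`. By Eisenstein at `none`, coefficients of integral elements lie in the valuation ring
-- of `none`. If the integral closure were finite, some `s` in `D`, a unit at `none`, would
-- therefore satisfy `s / (y₀ ⋯ yᵢ₋₁) ∈ D` for all `i`. But `s` involves only finitely many stages,
-- and from then on a unit at `none` is a unit at `some i`, where `yᵢ` is not
-- (`false_of_forall_mul_inv_mem_D`).

universe v w

/-! ### Extraction of `p`-power roots inside finite normal extensions of polynomial rings -/

section PolynomialRings

open MvPolynomial

/-- Over the fraction field the polynomial ring is normal, and a polynomial there that is integral
over the smaller ring has integral coefficients. -/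
theorem MvPolynomial.isIntegrallyClosed_of_isIntegrallyClosed {R : Type u} [CommRing R] [IsDomain R]
    [IsIntegrallyClosed R] (σ : Type v) : IsIntegrallyClosed (MvPolynomial σ R) := by
  let : Algebra (MvPolynomial σ R) (MvPolynomial σ (FractionRing R)) :=
    MvPolynomial.algebraMvPolynomial
  have hinj : Function.Injective (algebraMap (MvPolynomial σ R) (MvPolynomial σ (FractionRing R))) :=
    MvPolynomial.map_injective _ (IsFractionRing.injective R (FractionRing R))
  have : FaithfulSMul (MvPolynomial σ R) (MvPolynomial σ (FractionRing R)) :=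
    (faithfulSMul_iff_algebraMap_injective _ _).2 hinj
  have : IsIntegrallyClosedIn (MvPolynomial σ R) (MvPolynomial σ (FractionRing R)) := by
    refine isIntegrallyClosedIn_iff.mpr ⟨hinj, fun {f} hf => ?_⟩
    have h := MvPolynomial.isIntegral_iff_isIntegral_coeff.1 hf
    have h2 : f ∈ Set.range (MvPolynomial.map (σ := σ) (algebraMap R (FractionRing R))) := by
      rw [MvPolynomial.mem_range_map_iff_coeffs_subset]
      intro c hc
      obtain ⟨n, hn, rfl⟩ := MvPolynomial.mem_coeffs_iff.1 hc
      obtain ⟨y, hy⟩ := IsIntegrallyClosed.isIntegral_iff.1 (h n)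
      exact ⟨y, hy⟩
    exact h2
  exact IsIntegrallyClosed.of_isIntegrallyClosed_of_isIntegrallyClosedIn _
    (MvPolynomial σ (FractionRing R))

/-- Over a domain of exponential characteristic `p`, a family some of whose `p`-power powers are
positive powers of an algebraically independent family is algebraically independent. -/
theorem AlgebraicIndependent.of_pow_expChar {R : Type u} {E : Type v} {ι : Type w} [CommRing R]
    [CommRing E] [IsDomain E] [Algebra R E] (p : ℕ) [ExpChar E p] {x g : ι → E}
    (hx : AlgebraicIndependent R x) (n : ℕ) (e : ι → ℕ) (he : ∀ i, e i ≠ 0)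
    (h : ∀ i, g i ^ p ^ n = x i ^ e i) : AlgebraicIndependent R g := by
  have hRE := hx.algebraMap_injective
  have : ExpChar R p := (RingHom.expChar_iff (algebraMap R E) hRE p).2 inferInstance
  have : IsDomain R := hRE.isDomain (algebraMap R E)
  let Ψ : MvPolynomial ι R →+* E :=
    (aeval (R := R) fun i => x i ^ e i).toRingHom.comp
      (MvPolynomial.map (iterateFrobenius R p n))
  have hxe : AlgebraicIndependent R fun i => x i ^ e i := by
    have := hx.polynomial_aeval_of_transcendental (f := fun i => (Polynomial.X : Polynomial R) ^ e i)
      fun i => (Polynomial.transcendental_X (R := R)).pow (Nat.pos_of_ne_zero (he i))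
    simpa using this
  -- Raising a relation among the `g i` to the power `p ^ n` gives a relation, with
  -- Frobenius-twisted coefficients, among powers of the `x i`.
  have key : (iterateFrobenius E p n).comp (aeval (R := R) g).toRingHom = Ψ := by
    refine MvPolynomial.ringHom_ext (fun r => ?_) (fun i => ?_)
    · simp [Ψ, iterateFrobenius_def]
    · simp [Ψ, iterateFrobenius_def, h]
  rw [algebraicIndependent_iff]
  intro F hF
  have h1 : Ψ F = 0 := by
    rw [← key]
    simp [hF]
  have h2 : MvPolynomial.map (iterateFrobenius R p n) F = 0 := hxe.eq_zero_of_aeval_eq_zero _ h1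
  exact (MvPolynomial.map_injective _ (iterateFrobenius_inj R p n)) (by simpa using h2)

variable {A : Type u} [CommRing A] {σ : Type w} {E : Type u} [Field E]
  [Algebra A E] [Algebra (MvPolynomial σ A) E] [IsScalarTower A (MvPolynomial σ A) E]

/-- If a finite normal extension `B` of `A` contains the `p ^ n`-th roots of the coefficients of
finitely many polynomials over `A`, then the `p ^ n`-th roots of these polynomials lie in a normal
domain which is finite over the polynomial ring over `A`. -/
theorem exists_finite_isIntegrallyClosed_pow_eq_of_finite [IsAlgClosed E]
    [FaithfulSMul (MvPolynomial σ A) E] {B : Type u} [CommRing B] [IsDomain B]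
    [IsIntegrallyClosed B] [Algebra A B] [Module.Finite A B] [Algebra B E] [IsScalarTower A B E]
    (p : ℕ) [ExpChar E p] (n : ℕ) (F : Finset (MvPolynomial σ A))
    (hB : ∀ f ∈ F, ∀ m ∈ f.support, ∃ b : B, algebraMap B E b ^ p ^ n = algebraMap A E (f.coeff m)) :
    ∃ Q : Subalgebra (MvPolynomial σ A) E, Module.Finite (MvPolynomial σ A) Q ∧
      IsIntegrallyClosed Q ∧
      ∀ f ∈ F, ∃ N ∈ Q, N ^ p ^ n = algebraMap (MvPolynomial σ A) E f := by
  classical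
  have hq : 0 < p ^ n := pow_pos (expChar_pos E p) n
  have hroot : ∀ a : E, ∃ z : E, z ^ p ^ n = a := fun a => IsAlgClosed.exists_pow_nat_eq a hq
  choose rt hrt using hroot
  let x : σ → E := fun i => algebraMap (MvPolynomial σ A) E (X i)
  have haeval : ∀ f : MvPolynomial σ A, algebraMap (MvPolynomial σ A) E f = aeval x f := by
    intro f
    have : IsScalarTower.toAlgHom A (MvPolynomial σ A) E = aeval x := by
      ext i; simp [x]
    exact DFunLike.congr_fun this f
  have hx : AlgebraicIndependent A x := by
    rw [algebraicIndependent_iff]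
    intro f hf
    rw [← haeval] at hf
    exact FaithfulSMul.algebraMap_injective (MvPolynomial σ A) E (by simpa using hf)
  -- Roots are taken only of the finitely many variables that occur in `F`; this keeps `Q` finite
  -- although `σ` may be infinite.
  let s : Finset σ := F.biUnion fun f => f.vars
  let g : σ → E := fun i => if i ∈ s then rt (x i) else x i
  let e : σ → ℕ := fun i => if i ∈ s then 1 else p ^ n
  have hge : ∀ i, g i ^ p ^ n = x i ^ e i := by
    intro i
    by_cases hi : i ∈ s <;> simp [g, e, hi, hrt]
  have hg : AlgebraicIndependent B g := by
    refine AlgebraicIndependent.of_pow_expChar p (hx.extendScalars_of_isIntegral B) n e ?_ hge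
    intro i
    by_cases hi : i ∈ s <;> simp [e, hi]
    exact fun h => absurd h (expChar_pos E p).ne'
  let f : MvPolynomial σ B →ₐ[B] E := aeval g
  have hxmem : ∀ i, x i ∈ f.range := by
    intro i
    by_cases hi : i ∈ s
    · refine ⟨X i ^ p ^ n, ?_⟩
      simp [f, g, hi, hrt]
    · exact ⟨X i, by simp [f, g, hi]⟩
  have hPmem : ∀ r : MvPolynomial σ A, algebraMap (MvPolynomial σ A) E r ∈ f.range := by
    intro r
    rw [haeval]
    induction r using MvPolynomial.induction_on with
    | C a =>
      rw [aeval_C, IsScalarTower.algebraMap_apply A B E]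
      exact f.range.algebraMap_mem _
    | add a b ha hb => rw [map_add]; exact add_mem ha hb
    | mul_X a i ha => rw [map_mul, aeval_X]; exact mul_mem ha (hxmem i)
  let Q : Subalgebra (MvPolynomial σ A) E :=
    { f.range.toSubring.toSubsemiring with algebraMap_mem' := hPmem }
  refine ⟨Q, ?_, ?_, ?_⟩
  · obtain ⟨T, hT⟩ := Module.Finite.fg_top (R := A) (M := B)
    let G : Set E := (algebraMap B E '' T) ∪ (g '' s)
    have hGfin : G.Finite := (T.finite_toSet.image _).union (s.finite_toSet.image _)
    have hGint : ∀ z ∈ G, IsIntegral (MvPolynomial σ A) z := by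
      rintro _ (⟨a, -, rfl⟩ | ⟨i, hi, rfl⟩)
      · have : IsIntegral A (algebraMap B E a) :=
          (Algebra.IsIntegral.isIntegral (R := A) a).algebraMap
        exact this.tower_top
      · refine IsIntegral.of_pow hq ?_
        rw [hge]
        exact IsIntegral.pow isIntegral_algebraMap _
    have hAG : ∀ a : B, algebraMap B E a ∈ Algebra.adjoin (MvPolynomial σ A) G := by
      intro a
      have ha : a ∈ Submodule.span A (T : Set B) := hT ▸ Submodule.mem_top
      induction ha using Submodule.span_induction with
      | mem a ha => exact Algebra.subset_adjoin (Or.inl ⟨a, ha, rfl⟩)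
      | zero => rw [map_zero]; exact zero_mem _
      | add a b _ _ ha hb => rw [map_add]; exact add_mem ha hb
      | smul r a _ ha =>
        rw [Algebra.smul_def, map_mul, ← IsScalarTower.algebraMap_apply A B E,
          IsScalarTower.algebraMap_apply A (MvPolynomial σ A) E]
        exact mul_mem (Subalgebra.algebraMap_mem _ _) ha
    have hgG : ∀ i, g i ∈ Algebra.adjoin (MvPolynomial σ A) G := by
      intro i
      by_cases hi : i ∈ s
      · exact Algebra.subset_adjoin (Or.inr ⟨i, hi, rfl⟩)
      · have : g i = algebraMap (MvPolynomial σ A) E (X i) := by simp [g, hi, x]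
        rw [this]
        exact Subalgebra.algebraMap_mem _ _
    have hQ : Q = Algebra.adjoin (MvPolynomial σ A) G := by
      apply le_antisymm
      · rintro _ ⟨r, rfl⟩
        change aeval g r ∈ _
        induction r using MvPolynomial.induction_on with
        | C a => rw [aeval_C]; exact hAG a
        | add a b ha hb => rw [map_add]; exact add_mem ha hb
        | mul_X a i ha => rw [map_mul, aeval_X]; exact mul_mem ha (hgG i)
      · refine Algebra.adjoin_le ?_
        rintro _ (⟨a, -, rfl⟩ | ⟨i, hi, rfl⟩)
        · exact f.range.algebraMap_mem a
        · exact ⟨X i, by simp [f]⟩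
    rw [hQ]
    exact Module.Finite.iff_fg.2 (fg_adjoin_of_finite hGfin hGint)
  · have := MvPolynomial.isIntegrallyClosed_of_isIntegrallyClosed (R := B) σ
    have e1 : MvPolynomial σ B ≃ₐ[B] f.range := AlgEquiv.ofInjective f hg
    have e2 : f.range ≃+* Q :=
      { toFun := fun z => ⟨z.1, z.2⟩
        invFun := fun z => ⟨z.1, z.2⟩
        left_inv := fun _ => rfl
        right_inv := fun _ => rfl
        map_mul' := fun _ _ => rfl
        map_add' := fun _ _ => rfl }
    exact IsIntegrallyClosed.of_equiv (e1.toRingEquiv.trans e2)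
  · have hgf : ∀ i, g i ∈ f.range := fun i => ⟨X i, by simp [f]⟩
    intro r hr
    have hmon : ∀ m ∈ r.support, ∃ N ∈ f.range, N ^ p ^ n = aeval x (monomial m (r.coeff m)) := by
      intro m hm
      obtain ⟨b, hb⟩ := hB r hr m hm
      refine ⟨algebraMap B E b * m.prod fun i k => g i ^ k, ?_, ?_⟩
      · exact mul_mem (f.range.algebraMap_mem b) (prod_mem fun i _ => pow_mem (hgf i) _)
      · rw [aeval_monomial, mul_pow, hb]
        congr 1
        rw [Finsupp.prod, Finsupp.prod, ← Finset.prod_pow]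
        refine Finset.prod_congr rfl fun i hi => ?_
        have his : i ∈ s := by
          simp only [s, Finset.mem_biUnion]
          exact ⟨r, hr, (mem_vars_iff_mem_support i).2 ⟨m, hm, hi⟩⟩
        rw [← pow_mul, mul_comm, pow_mul, hge]
        simp [e, his]
    choose! N hN1 hN2 using hmon
    refine ⟨∑ m ∈ r.support, N m, sum_mem fun m hm => hN1 m hm, ?_⟩
    -- The `p ^ n`-th power is additive, so the sum of the roots of the monomials is a root of the
    -- polynomial.
    rw [sum_pow_char_pow, haeval]
    conv_rhs => rw [r.as_sum, map_sum]
    exact Finset.sum_congr rfl fun m hm => hN2 m hm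

/-- If `A` is N-2, then finitely many `p`-power roots of polynomials over `A` lie in a normal
domain which is finite over the polynomial ring. -/
theorem exists_finite_isIntegrallyClosed_pow_eq [IsAlgClosed E] [FaithfulSMul (MvPolynomial σ A) E]
    [IsDomain A] (hA : IsN2 A) (p : ℕ) [ExpChar E p] (n : ℕ) (F : Finset (MvPolynomial σ A)) :
    ∃ Q : Subalgebra (MvPolynomial σ A) E, Module.Finite (MvPolynomial σ A) Q ∧
      IsIntegrallyClosed Q ∧
      ∀ f ∈ F, ∃ N ∈ Q, N ^ p ^ n = algebraMap (MvPolynomial σ A) E f := by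
  classical
  have hq : 0 < p ^ n := pow_pos (expChar_pos E p) n
  have hAE : Function.Injective (algebraMap A E) := by
    rw [IsScalarTower.algebraMap_eq A (MvPolynomial σ A) E]
    exact (FaithfulSMul.algebraMap_injective (MvPolynomial σ A) E).comp
      (MvPolynomial.C_injective σ A)
  have : FaithfulSMul A E := (faithfulSMul_iff_algebraMap_injective _ _).2 hAE
  have hroot : ∀ a : E, ∃ z : E, z ^ p ^ n = a := fun a => IsAlgClosed.exists_pow_nat_eq a hq
  choose rt hrt using hroot
  let W : Finset A := F.biUnion fun f => f.support.image fun m => f.coeff m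
  let : Algebra (FractionRing A) E := FractionRing.liftAlgebra A E
  have : IsScalarTower A (FractionRing A) E := FractionRing.isScalarTower_liftAlgebra A E
  let Z : Set E := ((fun a => rt (algebraMap A E a)) '' (W : Set A))
  have hZint : ∀ a : A, IsIntegral A (rt (algebraMap A E a)) := fun a =>
    IsIntegral.of_pow hq (by rw [hrt]; exact isIntegral_algebraMap)
  -- Adjoining the roots of finitely many coefficients is a finite extension, so N-2 makes the
  -- integral closure of `A` in it finite; this is the coefficient ring `B`.
  let K' : IntermediateField (FractionRing A) E := IntermediateField.adjoin (FractionRing A) Z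
  have : Finite Z := (W.finite_toSet.image _).to_subtype
  have : FiniteDimensional (FractionRing A) K' := IntermediateField.finiteDimensional_adjoin (by
    rintro _ ⟨a, -, rfl⟩
    exact (hZint a).tower_top)
  have hfin : Module.Finite A (integralClosure A K') := hA K'
  have : IsIntegrallyClosed (integralClosure A K') :=
    integralClosure.isIntegrallyClosedOfFiniteExtension (FractionRing A)
  have : IsScalarTower A K' E := IsScalarTower.of_algebraMap_eq (fun a => rfl)
  have : IsScalarTower A (integralClosure A K') E := IsScalarTower.of_algebraMap_eq (fun a => rfl)
  refine exists_finite_isIntegrallyClosed_pow_eq_of_finite (B := integralClosure A K') p n F ?_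
  intro r hr m hm
  have hrmem : rt (algebraMap A E (r.coeff m)) ∈ Z :=
    ⟨r.coeff m, by
      simp only [W, Finset.coe_biUnion, Set.mem_iUnion]
      exact ⟨r, hr, by simpa using ⟨m, by simpa using hm, rfl⟩⟩, rfl⟩
  let z : K' := ⟨_, IntermediateField.subset_adjoin _ _ hrmem⟩
  have hz : IsIntegral A z :=
    (isIntegral_algebraMap_iff (B := E) (algebraMap K' E).injective).1 (hZint (r.coeff m))
  exact ⟨⟨z, hz⟩, hrt _⟩

end PolynomialRings

/-! ### Noetherian localizations of polynomial rings over N-2 domains -/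

section PolynomialRingsN2

open MvPolynomial

variable {A : Type u} [CommRing A] [IsDomain A] {σ : Type w}

/-- If `A` is N-2, then finitely many algebraic elements over the field of fractions of a polynomial
ring over `A` are separable over the field of fractions of a normal domain which is finite over the
polynomial ring. -/
theorem exists_finite_isIntegrallyClosed_separable {E : Type u} [Field E]
    [Algebra A E] [Algebra (MvPolynomial σ A) E] [IsScalarTower A (MvPolynomial σ A) E]
    [IsAlgClosed E] [FaithfulSMul (MvPolynomial σ A) E] (hA : IsN2 A) {F : Type u} [Field F]
    [Algebra (MvPolynomial σ A) F] [IsFractionRing (MvPolynomial σ A) F] [Algebra F E]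
    [IsScalarTower (MvPolynomial σ A) F E] (T : Finset E) (hT : ∀ t ∈ T, IsIntegral F t) :
    ∃ Q : Subalgebra (MvPolynomial σ A) E, Module.Finite (MvPolynomial σ A) Q ∧
      IsIntegrallyClosed Q ∧
      ∀ t ∈ T, ∃ f : Polynomial E, f.Separable ∧ f.eval t = 0 ∧
        ∀ i, ∃ a ∈ Q, ∃ b ∈ Q, b ≠ 0 ∧ f.coeff i * b = a := by
  classical
  obtain ⟨p, hp⟩ := ExpChar.exists E
  have hp' : ExpChar F p := (RingHom.expChar_iff (algebraMap F E) (algebraMap F E).injective p).2 hp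
  -- The perfect closure of `F` in `E` is perfect, so these minimal polynomials are separable; each
  -- of their coefficients has a `p`-power power in `F`.
  let f : E → Polynomial E := fun t =>
    (minpoly (perfectClosure F E) t).map (algebraMap (perfectClosure F E) E)
  let C : Finset E := T.biUnion fun t => (f t).support.image (f t).coeff
  have hC : ∀ c ∈ C, ∃ n : ℕ, ∃ z : F, c ^ p ^ n = algebraMap F E z := by
    intro c hc
    simp only [C, Finset.mem_biUnion, Finset.mem_image] at hc
    obtain ⟨t, -, i, -, rfl⟩ := hc
    have h : (f t).coeff i ∈ perfectClosure F E := by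
      simp only [f, Polynomial.coeff_map]
      exact ((minpoly (perfectClosure F E) t).coeff i).2
    obtain ⟨n, z, hz⟩ := (mem_perfectClosure_iff_pow_mem p).1 h
    exact ⟨n, z, hz.symm⟩
  choose! n z hz using hC
  let N := C.sup n
  have hzN : ∀ c ∈ C, c ^ p ^ N = algebraMap F E (z c ^ p ^ (N - n c)) := by
    intro c hc
    rw [map_pow, ← hz c hc, ← pow_mul, ← pow_add, Nat.add_sub_cancel' (Finset.le_sup hc)]
  have hfrac : ∀ c ∈ C, ∃ num den : MvPolynomial σ A, den ≠ 0 ∧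
      c ^ p ^ N * algebraMap _ E den = algebraMap _ E num := by
    intro c hc
    obtain ⟨num, den, hden, h⟩ := IsFractionRing.div_surjective (A := MvPolynomial σ A)
      (z c ^ p ^ (N - n c))
    refine ⟨num, den, nonZeroDivisors.ne_zero hden, ?_⟩
    rw [hzN c hc, ← h, IsScalarTower.algebraMap_apply (MvPolynomial σ A) F E den,
      IsScalarTower.algebraMap_apply (MvPolynomial σ A) F E num, ← map_mul, div_mul_cancel₀]
    exact (map_ne_zero_iff _ (IsFractionRing.injective _ F)).2 (nonZeroDivisors.ne_zero hden)
  choose! num den hden hnd using hfrac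
  obtain ⟨Q, hQ1, hQ2, hQ⟩ := exists_finite_isIntegrallyClosed_pow_eq hA p N
    (E := E) (C.image num ∪ C.image den)
  refine ⟨Q, hQ1, hQ2, fun t ht => ⟨f t, ?_, ?_, fun i => ?_⟩⟩
  · have hint : IsIntegral (perfectClosure F E) t := (hT t ht).tower_top
    exact (PerfectField.separable_of_irreducible (minpoly.irreducible hint)).map
  · simp only [f, Polynomial.eval_map_algebraMap, minpoly.aeval]
  · by_cases hi : (f t).coeff i = 0
    · exact ⟨0, Q.zero_mem, 1, Q.one_mem, one_ne_zero, by simp [hi]⟩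
    have hc : (f t).coeff i ∈ C := by
      simp only [C, Finset.mem_biUnion, Finset.mem_image]
      exact ⟨t, ht, i, by simpa using hi, rfl⟩
    obtain ⟨a, ha, haN⟩ := hQ (num ((f t).coeff i))
      (Finset.mem_union_left _ (Finset.mem_image_of_mem _ hc))
    obtain ⟨b, hb, hbN⟩ := hQ (den ((f t).coeff i))
      (Finset.mem_union_right _ (Finset.mem_image_of_mem _ hc))
    refine ⟨a, ha, b, hb, ?_, ?_⟩
    · rintro rfl
      rw [zero_pow (pow_pos (expChar_pos E p) N).ne'] at hbN
      exact hden _ hc (FaithfulSMul.algebraMap_injective (MvPolynomial σ A) E (by simpa using hbN.symm))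
    · apply iterateFrobenius_inj E p N
      rw [iterateFrobenius_def, iterateFrobenius_def, mul_pow, haN, hbN, hnd _ hc]

/-- Let `Q` be a normal domain which is finite over `P`, inside a field `E`, and let `T` be a finite
set of elements of `E` which are separable over the field of fractions `K` of `Q`. Then the
elements of `K(T)` which are integral over `P` lie in a finite `P`-submodule of `E`. -/
theorem exists_finset_forall_isIntegral_mem_span {P : Type v} {Q K E : Type*} [CommRing P]
    [CommRing Q] [IsDomain Q] [IsIntegrallyClosed Q] [Algebra P Q] [Module.Finite P Q]
    [Field K] [Algebra Q K] [IsFractionRing Q K] [Field E] [Algebra K E] [Algebra Q E]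
    [IsScalarTower Q K E] [Algebra P E] [IsScalarTower P Q E]
    (T : Finset E) (hsep : ∀ t ∈ T, IsSeparable K t) :
    ∃ W : Finset E, ∀ x ∈ IntermediateField.adjoin K (T : Set E), IsIntegral P x →
      x ∈ Submodule.span P (W : Set E) := by
  classical
  let L' : IntermediateField K E := IntermediateField.adjoin K (T : Set E)
  have : FiniteDimensional K L' := IntermediateField.finiteDimensional_adjoin
    fun t ht => (hsep t ht).isIntegral
  have : Algebra.IsSeparable K L' :=
    (IntermediateField.isSeparable_adjoin_iff_isSeparable K E).2 hsep
  obtain ⟨s, b, hb⟩ := FiniteDimensional.exists_is_basis_integral Q K L'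
  -- Separability makes the trace form nondegenerate, and the dual of a basis of integral elements
  -- spans a `Q`-module containing every integral element.
  let b' := (Algebra.traceForm K L').dualBasis (traceForm_nondegenerate K L') b
  have hle := integralClosure_le_span_dualBasis b hb
  obtain ⟨G, hG⟩ := Module.Finite.fg_top (R := P) (M := Q)
  let W : Finset E :=
    (G ×ˢ Finset.univ).image fun z : Q × s => algebraMap Q E z.1 * (b' z.2 : E)
  refine ⟨W, fun x hx hxint => ?_⟩
  have hQL : IsScalarTower Q L' E := IsScalarTower.of_algebraMap_eq fun q => by
    rw [IsScalarTower.algebraMap_apply Q K E, IsScalarTower.algebraMap_apply Q K L',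
      ← IsScalarTower.algebraMap_apply K L' E]
  have hxQ : IsIntegral Q (⟨x, hx⟩ : L') := by
    have : IsIntegral Q x := hxint.tower_top
    exact (isIntegral_algebraMap_iff (B := E) (algebraMap L' E).injective).1 this
  have hmem := hle hxQ
  have hQspan : ∀ (q : Q) (i : s), algebraMap Q E q * (b' i : E) ∈ Submodule.span P (W : Set E) := by
    intro q i
    have hq : q ∈ Submodule.span P (G : Set Q) := hG ▸ Submodule.mem_top
    induction hq using Submodule.span_induction with
    | mem q hq =>
      refine Submodule.subset_span ?_
      simp only [W, Finset.coe_image, Finset.coe_product, Set.mem_image]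
      exact ⟨(q, i), ⟨hq, by simp⟩, rfl⟩
    | zero => simp
    | add q r _ _ hq hr =>
      rw [map_add, add_mul]
      exact add_mem hq hr
    | smul a q _ hq =>
      rw [Algebra.algebraMap_eq_smul_one, smul_assoc, smul_mul_assoc,
        ← Algebra.algebraMap_eq_smul_one]
      exact Submodule.smul_mem _ a hq
  obtain ⟨c, hc⟩ := (Submodule.mem_span_range_iff_exists_fun Q).1 hmem
  have hx' : x = ∑ i, algebraMap Q E (c i) * (b' i : E) := by
    have := congrArg (algebraMap L' E) hc
    rw [map_sum] at this
    refine Eq.trans this.symm (Finset.sum_congr rfl fun i _ => ?_)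
    rw [Algebra.smul_def, map_mul, ← IsScalarTower.algebraMap_apply Q L' E]
    rfl
  rw [hx']
  exact sum_mem fun i _ => hQspan (c i) i

/-- The polynomial descends to `K`, where it stays separable, and the minimal polynomial of `t`
divides it. -/
theorem isSeparable_of_separable_of_coeff {Q K E : Type*} [CommRing Q] [IsDomain Q] [Field K]
    [Algebra Q K] [IsFractionRing Q K] [Field E] [Algebra K E] [Algebra Q E] [IsScalarTower Q K E]
    {t : E} {f : Polynomial E} (hf : f.Separable) (hft : f.eval t = 0)
    (hfQ : ∀ i, ∃ a b : Q, algebraMap Q E b ≠ 0 ∧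
      f.coeff i * algebraMap Q E b = algebraMap Q E a) :
    IsSeparable K t := by
  have hlift : f ∈ Polynomial.lifts (algebraMap K E) := by
    rw [Polynomial.lifts_iff_coeff_lifts]
    intro i
    obtain ⟨a, b, hb0, h⟩ := hfQ i
    refine ⟨algebraMap Q K a / algebraMap Q K b, ?_⟩
    rw [map_div₀, ← IsScalarTower.algebraMap_apply, ← IsScalarTower.algebraMap_apply, ← h,
      mul_div_cancel_right₀ _ hb0]
  obtain ⟨g, rfl⟩ := (Polynomial.mem_lifts f).1 hlift
  rw [Polynomial.separable_map] at hf
  refine hf.of_dvd (minpoly.dvd K t ?_)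
  rwa [Polynomial.eval_map_algebraMap] at hft

/-- Let `S` be a Noetherian localization of `P`, and let `L` be a finite extension of its field of
fractions `F` which is generated, inside a field `E`, by elements which are separable over the field
of fractions of a normal domain that is finite over `P`. Then the integral closure of `S` in `L`
is finite. -/
theorem finite_integralClosure_of_isSeparable {P S F L Q K E : Type*} [CommRing P] [CommRing S]
    [IsNoetherianRing S] [Algebra P S] (M : Submonoid P) [IsLocalization M S] [Field F]
    [Algebra P F] [IsFractionRing P F] [Field L] [Algebra F L] [Algebra S L]
    [CommRing Q] [IsDomain Q] [IsIntegrallyClosed Q] [Algebra P Q] [Module.Finite P Q]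
    [Field K] [Algebra Q K] [IsFractionRing Q K] [Field E] [Algebra K E] [Algebra Q E]
    [IsScalarTower Q K E] [Algebra P E] [IsScalarTower P Q E] [Algebra S E] [IsScalarTower P S E]
    [Algebra L E] [Algebra F E] [IsScalarTower F L E] [IsScalarTower S L E] [IsScalarTower P F E]
    (T : Finset L) (hT : Submodule.span F (T : Set L) = ⊤)
    (hsep : ∀ t ∈ T, IsSeparable K (algebraMap L E t)) :
    Module.Finite S (integralClosure S L) := by
  classical
  let T' : Finset E := T.image (algebraMap L E)
  obtain ⟨W, hW⟩ := exists_finset_forall_isIntegral_mem_span (P := P) (Q := Q) (K := K) T' (by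
    intro t ht
    obtain ⟨l, hl, rfl⟩ := Finset.mem_image.1 ht
    exact hsep l hl)
  have hP : ∀ z : P, algebraMap P E z ∈ IntermediateField.adjoin K (T' : Set E) := by
    intro z
    rw [IsScalarTower.algebraMap_apply P Q E, IsScalarTower.algebraMap_apply Q K E]
    exact IntermediateField.algebraMap_mem _ _
  have hLmem : ∀ l : L, algebraMap L E l ∈ IntermediateField.adjoin K (T' : Set E) := by
    intro l
    have hl : l ∈ Submodule.span F (T : Set L) := hT ▸ Submodule.mem_top
    induction hl using Submodule.span_induction with
    | mem t ht => exact IntermediateField.subset_adjoin _ _ (Finset.mem_image_of_mem _ ht)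
    | zero => rw [map_zero]; exact zero_mem _
    | add a b _ _ ha hb => rw [map_add]; exact add_mem ha hb
    | smul r a _ ha =>
      rw [Algebra.smul_def, map_mul, ← IsScalarTower.algebraMap_apply F L E]
      refine mul_mem ?_ ha
      obtain ⟨a, b, hb, h⟩ := IsFractionRing.div_surjective (A := P) r
      rw [← h, map_div₀, ← IsScalarTower.algebraMap_apply, ← IsScalarTower.algebraMap_apply]
      exact div_mem (hP a) (hP b)
  let ψ : integralClosure S L →ₗ[S] E :=
    (IsScalarTower.toAlgHom S L E).toLinearMap.comp (integralClosure S L).val.toLinearMap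
  have hψ : ∀ l, ψ l ∈ Submodule.span S (W : Set E) := by
    intro l
    have hint : IsIntegral S (algebraMap L E l) := IsIntegral.algebraMap l.2
    -- Clearing denominators makes the element integral over `P`; the multiplier becomes a unit of
    -- `S`, so the element lies in the `S`-span of `W`. As `S` is Noetherian, a submodule of that
    -- span is finite.
    obtain ⟨m, hm⟩ := IsIntegral.exists_multiple_integral_of_isLocalization M _ hint
    have hmem : m • algebraMap L E (l : L) ∈ Submodule.span P (W : Set E) := by
      refine hW _ ?_ hm
      rw [Submonoid.smul_def, Algebra.smul_def]
      exact mul_mem (hP m) (hLmem l)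
    have hmem' := Submodule.span_le_restrictScalars P S (W : Set E) hmem
    obtain ⟨u, hu⟩ := IsLocalization.map_units S m
    have : ψ l = (↑u⁻¹ : S) • (m • algebraMap L E (l : L)) := by
      rw [Submonoid.smul_def, ← algebraMap_smul S (m : P), ← hu, smul_smul,
        Units.inv_mul, one_smul]
      rfl
    rw [this]
    exact Submodule.smul_mem _ _ hmem'
  have : IsNoetherian S (Submodule.span S (W : Set E)) := isNoetherian_span_of_finite S W.finite_toSet
  refine Module.Finite.of_injective (ψ.codRestrict _ hψ) ?_
  intro a b hab
  exact Subtype.ext ((algebraMap L E).injective (congrArg Subtype.val hab))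

theorem finite_integralClosure_of_isAlgClosed (hA : IsN2 A) (M : Submonoid (MvPolynomial σ A))
    {S F L : Type u} [CommRing S] [Algebra (MvPolynomial σ A) S] [IsLocalization M S]
    [IsNoetherianRing S] [Field F] [Algebra (MvPolynomial σ A) F]
    [IsFractionRing (MvPolynomial σ A) F] [Field L] [Algebra F L] [FiniteDimensional F L]
    [Algebra S L] {E : Type u} [Field E] [IsAlgClosed E] [Algebra A E]
    [Algebra (MvPolynomial σ A) E] [IsScalarTower A (MvPolynomial σ A) E]
    [FaithfulSMul (MvPolynomial σ A) E] [Algebra S E] [IsScalarTower (MvPolynomial σ A) S E]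
    [Algebra L E] [Algebra F E] [IsScalarTower F L E] [IsScalarTower S L E]
    [IsScalarTower (MvPolynomial σ A) F E] :
    Module.Finite S (integralClosure S L) := by
  classical
  obtain ⟨T, hT⟩ := Module.Finite.fg_top (R := F) (M := L)
  obtain ⟨Q, hQ1, hQ2, hQ⟩ := exists_finite_isIntegrallyClosed_separable (E := E) (σ := σ) hA (F := F)
    (T.image (algebraMap L E)) (by
      intro t ht
      obtain ⟨l, -, rfl⟩ := Finset.mem_image.1 ht
      exact (Algebra.IsIntegral.isIntegral (R := F) l).algebraMap)
  have : FaithfulSMul Q E := inferInstance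
  let : Algebra (FractionRing Q) E := FractionRing.liftAlgebra Q E
  have : IsScalarTower Q (FractionRing Q) E := FractionRing.isScalarTower_liftAlgebra Q E
  refine finite_integralClosure_of_isSeparable (F := F) (Q := Q) (K := FractionRing Q) (E := E)
    M T hT fun t ht => ?_
  obtain ⟨f, hf, hft, hfQ⟩ := hQ (algebraMap L E t) (Finset.mem_image_of_mem _ ht)
  refine isSeparable_of_separable_of_coeff (Q := Q) hf hft fun i => ?_
  obtain ⟨a, ha, b, hb, hb0, h⟩ := hfQ i
  exact ⟨⟨a, ha⟩, ⟨b, hb⟩, hb0, h⟩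

/-- Noetherian localizations of polynomial rings over N-2 domains are N-2. -/
theorem IsN2.of_isLocalization_mvPolynomial (hA : IsN2 A) (M : Submonoid (MvPolynomial σ A))
    (hM : M ≤ nonZeroDivisors (MvPolynomial σ A)) (S : Type u) [CommRing S] [IsDomain S]
    [Algebra (MvPolynomial σ A) S] [IsLocalization M S] [IsNoetherianRing S] : IsN2 S := by
  classical
  intro L _ _ _ _ _
  let F := FractionRing S
  let E := AlgebraicClosure L
  have hPF : Function.Injective (algebraMap (MvPolynomial σ A) F) := by
    rw [IsScalarTower.algebraMap_eq (MvPolynomial σ A) S F]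
    exact (IsFractionRing.injective S F).comp (IsLocalization.injective S hM)
  have : FaithfulSMul (MvPolynomial σ A) F := (faithfulSMul_iff_algebraMap_injective _ _).2 hPF
  have : IsFractionRing (MvPolynomial σ A) F := IsFractionRing.of_field _ _ fun z => by
    obtain ⟨a, b, -, rfl⟩ := IsFractionRing.div_surjective (A := S) z
    obtain ⟨⟨a, m⟩, rfl⟩ := IsLocalization.mk'_surjective M a
    obtain ⟨⟨b, n⟩, rfl⟩ := IsLocalization.mk'_surjective M b
    refine ⟨a * n, b * m, ?_⟩
    have h : ∀ (a : MvPolynomial σ A) (m : M), algebraMap S F (IsLocalization.mk' S a m) =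
        algebraMap _ F a / algebraMap _ F (m : MvPolynomial σ A) := by
      intro a m
      rw [eq_div_iff ((map_ne_zero_iff _ hPF).2 (nonZeroDivisors.ne_zero (hM m.2))),
        IsScalarTower.algebraMap_apply (MvPolynomial σ A) S F,
        IsScalarTower.algebraMap_apply (MvPolynomial σ A) S F, ← map_mul, IsLocalization.mk'_spec]
    rw [h, h, map_mul, map_mul, div_div_div_eq, mul_comm (algebraMap _ F b)]
  let : Algebra (MvPolynomial σ A) E :=
    ((algebraMap F E).comp (algebraMap (MvPolynomial σ A) F)).toAlgebra
  let : Algebra A E :=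
    ((algebraMap (MvPolynomial σ A) E).comp (algebraMap A (MvPolynomial σ A))).toAlgebra
  have : IsScalarTower A (MvPolynomial σ A) E := IsScalarTower.of_algebraMap_eq fun _ => rfl
  have : IsScalarTower (MvPolynomial σ A) F E := IsScalarTower.of_algebraMap_eq fun _ => rfl
  have : FaithfulSMul (MvPolynomial σ A) E := (faithfulSMul_iff_algebraMap_injective _ _).2
    ((algebraMap F E).injective.comp (IsFractionRing.injective (MvPolynomial σ A) F))
  have : IsScalarTower S L E := inferInstance
  have : IsScalarTower (MvPolynomial σ A) S E := IsScalarTower.of_algebraMap_eq fun z => by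
    rw [IsScalarTower.algebraMap_apply S L E, IsScalarTower.algebraMap_apply S F L,
      ← IsScalarTower.algebraMap_apply F L E, ← IsScalarTower.algebraMap_apply _ S F]
    rfl
  exact finite_integralClosure_of_isAlgClosed (E := E) (F := F) hA M

end PolynomialRingsN2

/-! ### N-2 discrete valuation rings are universally Japanese -/

section UniversallyJapanese

open MvPolynomial

theorem IsN2.mvPolynomial {A : Type u} [CommRing A] [IsDomain A] [IsNoetherianRing A]
    (hA : IsN2 A) (s : ℕ) : IsN2 (MvPolynomial (Fin s) A) := by
  have : IsLocalization (⊥ : Submonoid (MvPolynomial (Fin s) A)) (MvPolynomial (Fin s) A) :=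
    IsLocalization.self (by simp)
  exact hA.of_isLocalization_mvPolynomial (σ := Fin s) ⊥ bot_le _

theorem IsN2.of_field (k : Type u) [Field k] : IsN2 k := by
  intro L _ _ _ _ _
  have : Module.Finite k (FractionRing k) :=
    Module.Finite.of_surjective (Algebra.linearMap k (FractionRing k))
      (IsFractionRing.surjective_iff_isField.2 (Field.toIsField k))
  have : Module.Finite k L := Module.Finite.trans (FractionRing k) L
  exact Module.Finite.of_injective (integralClosure k L).val.toLinearMap Subtype.val_injective

/-- If `r • x` is integral over `P` up to powers of `r` for all `x` in `B`, then the same holds for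
all `x` that are integral over `B`. -/
theorem IsIntegral.exists_pow_smul_isIntegral {P B L : Type*} [CommRing P] [CommRing B] [CommRing L]
    [Algebra P B] [Algebra B L] [Algebra P L] [IsScalarTower P B L] {r : B} (hr : IsIntegral P r)
    (h : ∀ b : B, ∃ m : ℕ, IsIntegral P (r ^ m * b)) {x : L} (hx : IsIntegral B x) :
    ∃ m : ℕ, IsIntegral P (r ^ m • x) := by
  classical
  obtain ⟨f, hf, hfx⟩ := hx
  choose m hm using h
  let M := f.support.sup fun i => m (f.coeff i)
  have hM : ∀ i, IsIntegral P (r ^ M * f.coeff i) := by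
    intro i
    by_cases hi : i ∈ f.support
    · have : m (f.coeff i) ≤ M := Finset.le_sup (f := fun i => m (f.coeff i)) hi
      rw [← Nat.sub_add_cancel this, pow_add, mul_assoc]
      exact (hr.pow _).mul (hm _)
    · rw [Polynomial.notMem_support_iff.1 hi, mul_zero]
      exact isIntegral_zero
  refine ⟨M, ?_⟩
  by_cases hL : Subsingleton L
  · exact ⟨Polynomial.X, Polynomial.monic_X, Subsingleton.elim _ _⟩
  rw [not_subsingleton_iff_nontrivial] at hL
  have hB : Nontrivial B := (algebraMap B L).domain_nontrivial
  by_cases hdeg : f.natDegree = 0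
  · rw [hf.natDegree_eq_zero.1 hdeg] at hfx
    simp at hfx
  -- In degree `d` the `i`-th coefficient acquires the factor `r ^ (M * (d - i))`, which makes it
  -- integral over `P` for `i < d`, while the leading coefficient remains `1`.
  let g := (f.scaleRoots (r ^ M)).map (algebraMap B L)
  have hg : g.Monic := ((Polynomial.monic_scaleRoots_iff _).2 hf).map _
  refine IsIntegral.of_aeval_monic_of_isIntegral_coeff (p := g) hg ?_ ?_ ?_
  · rw [Polynomial.Monic.natDegree_map ((Polynomial.monic_scaleRoots_iff _).2 hf),
      Polynomial.natDegree_scaleRoots]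
    exact hdeg
  · have : g.eval (r ^ M • x) = 0 := by
      rw [Polynomial.eval_map, Algebra.smul_def]
      exact Polynomial.scaleRoots_eval₂_eq_zero _ hfx
    rw [this]
    exact isIntegral_zero
  · intro i
    rw [Polynomial.coeff_map, Polynomial.coeff_scaleRoots]
    refine IsIntegral.algebraMap ?_
    rcases lt_trichotomy i f.natDegree with hi | hi | hi
    · obtain ⟨k, hk⟩ := Nat.exists_eq_add_of_lt hi
      have : f.natDegree - i = k + 1 := by omega
      rw [this, pow_succ, mul_comm, mul_assoc]
      exact ((hr.pow M).pow k).mul (hM i)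
    · rw [hi, Nat.sub_self, pow_zero, mul_one, hf.coeff_natDegree]
      exact isIntegral_one
    · rw [Polynomial.coeff_eq_zero_of_natDegree_lt hi, zero_mul]
      exact isIntegral_zero

/-- Let `B` be a finite type extension of the N-2 domain `P` such that the elements of `B` are
integral over `P` after multiplication by a power of `r`. Then the integral closure of `B` is
finite up to multiplication by powers of `r`. -/
theorem IsN2.exists_finset_forall_pow_smul_mem_span {P B L : Type u} [CommRing P] [IsDomain P]
    (hP : IsN2 P) [CommRing B] [IsDomain B] [Algebra P B] [FaithfulSMul P B]
    [Algebra.FiniteType P B] [Field L] [Algebra B L] [IsFractionRing B L] {r : B} (hr0 : r ≠ 0)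
    (hr : IsIntegral P r) (h : ∀ b : B, ∃ m : ℕ, IsIntegral P (r ^ m * b)) :
    ∃ N : Finset L, (∀ n ∈ N, IsIntegral B n) ∧
      ∀ x : L, IsIntegral B x → ∃ m : ℕ, r ^ m • x ∈ Submodule.span B (N : Set L) := by
  classical
  let : Algebra P L := ((algebraMap B L).comp (algebraMap P B)).toAlgebra
  have : IsScalarTower P B L := IsScalarTower.of_algebraMap_eq fun _ => rfl
  have : FaithfulSMul P L := (faithfulSMul_iff_algebraMap_injective _ _).2
    ((IsFractionRing.injective B L).comp (FaithfulSMul.algebraMap_injective P B))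
  let : Algebra (FractionRing P) L := FractionRing.liftAlgebra P L
  have : IsScalarTower P (FractionRing P) L := FractionRing.isScalarTower_liftAlgebra P L
  -- `L` is essentially of finite type and algebraic over the fraction field of `P`, hence finite,
  -- and the N-2 property of `P` applies to it.
  have : Algebra.EssFiniteType B L := Algebra.EssFiniteType.of_isLocalization L (nonZeroDivisors B)
  have : Algebra.EssFiniteType P L := Algebra.EssFiniteType.comp P B L
  have : Algebra.EssFiniteType (FractionRing P) L := Algebra.EssFiniteType.of_comp P _ L
  have : Algebra.IsAlgebraic P B := by
    refine ⟨fun b => ?_⟩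
    obtain ⟨m, hm⟩ := h b
    have h1 : IsAlgebraic P (r ^ m * b) := hm.isAlgebraic
    have h2 : IsAlgebraic P (r ^ m) := (hr.pow m).isAlgebraic
    exact h2.of_mul (mem_nonZeroDivisors_of_ne_zero (pow_ne_zero m hr0)) h1
  have : Algebra.IsAlgebraic B L := IsLocalization.isAlgebraic L (nonZeroDivisors B)
  have : Algebra.IsAlgebraic P L := Algebra.IsAlgebraic.trans P B L
  have : Algebra.IsAlgebraic (FractionRing P) L := Algebra.IsAlgebraic.extendScalars (R := P) (IsFractionRing.injective P (FractionRing P))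
  have : FiniteDimensional (FractionRing P) L :=
    Algebra.finite_of_essFiniteType_of_isAlgebraic
  have hfin := hP L
  obtain ⟨N, hN⟩ := hfin.fg_top
  refine ⟨N.image Subtype.val, ?_, fun x hx => ?_⟩
  · intro n hn
    obtain ⟨c, -, rfl⟩ := Finset.mem_image.1 hn
    exact IsIntegral.tower_top c.2
  · obtain ⟨m, hm⟩ := IsIntegral.exists_pow_smul_isIntegral hr h hx
    refine ⟨m, ?_⟩
    have hmem : (⟨r ^ m • x, hm⟩ : integralClosure P L) ∈ Submodule.span P (N : Set _) :=
      hN ▸ Submodule.mem_top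
    have := Submodule.mem_map_of_mem (f := (integralClosure P L).val.toLinearMap) hmem
    rw [Submodule.map_span] at this
    rw [Finset.coe_image]
    exact Submodule.span_le_restrictScalars P B _ this

/-- The integral closure of `B` is finite if it is so locally, up to powers of elements that
generate the unit ideal. -/
theorem finite_integralClosure_of_forall_isMaximal {B L : Type*} [CommRing B] [Field L]
    [Algebra B L]
    (h : ∀ q : Ideal B, q.IsMaximal → ∃ r ∉ q, ∃ N : Finset L, (∀ n ∈ N, IsIntegral B n) ∧
      ∀ x : L, IsIntegral B x → ∃ m : ℕ, r ^ m • x ∈ Submodule.span B (N : Set L)) :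
    Module.Finite B (integralClosure B L) := by
  classical
  let Z : Set B := {r | ∃ N : Finset L, (∀ n ∈ N, IsIntegral B n) ∧
      ∀ x : L, IsIntegral B x → ∃ m : ℕ, r ^ m • x ∈ Submodule.span B (N : Set L)}
  have hZ : Ideal.span Z = ⊤ := by
    by_contra hne
    obtain ⟨q, hq, hle⟩ := Ideal.exists_le_maximal _ hne
    obtain ⟨r, hrq, hr⟩ := h q hq
    exact hrq (hle (Ideal.subset_span hr))
  obtain ⟨t, htZ, ht⟩ := (Ideal.span_eq_top_iff_finite Z).1 hZ
  have htZ' : ∀ r ∈ t, r ∈ Z := fun r hr => htZ hr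
  choose! N hN1 hN2 using htZ'
  let W := t.biUnion N
  have hW : Subalgebra.toSubmodule (integralClosure B L) = Submodule.span B (W : Set L) := by
    apply le_antisymm
    · intro x hx
      have hx' : IsIntegral B x := hx
      have : ∀ r ∈ t, ∃ m : ℕ, r ^ m • x ∈ Submodule.span B (N r : Set L) :=
        fun r hr => hN2 r hr x hx'
      choose! m hm using this
      -- The multipliers carrying `x` into the span form an ideal; it contains powers of generators
      -- of the unit ideal.
      let J : Ideal B := (Submodule.span B (W : Set L)).comap (LinearMap.toSpanSingleton B L x)
      have hJ : J = ⊤ := by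
        rw [eq_top_iff, ← Ideal.span_pow_eq_top _ ht (t.sup m), Ideal.span_le]
        rintro _ ⟨r, hr, rfl⟩
        change r ^ (t.sup m) • x ∈ Submodule.span B (W : Set L)
        have hle : m r ≤ t.sup m := Finset.le_sup hr
        rw [← Nat.sub_add_cancel hle, pow_add, mul_smul]
        refine Submodule.smul_mem _ _ (Submodule.span_mono ?_ (hm r hr))
        exact_mod_cast Finset.subset_biUnion_of_mem N hr
      have h1 : (1 : B) ∈ J := hJ ▸ Submodule.mem_top
      have h2 : (1 : B) • x ∈ Submodule.span B (W : Set L) := h1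
      rwa [one_smul] at h2
    · rw [Submodule.span_le]
      intro n hn
      obtain ⟨r, hr, hn⟩ := Finset.mem_biUnion.1 (Finset.mem_coe.1 hn)
      exact hN1 r hr n hn
  have : (Subalgebra.toSubmodule (integralClosure B L)).FG := hW ▸ ⟨W, rfl⟩
  exact Module.Finite.iff_fg.2 this

/-- Domains of finite type over a field are N-1. -/
theorem IsN1.of_finiteType_field (k : Type u) [Field k] (B : Type u) [CommRing B] [IsDomain B]
    [Algebra k B] [Algebra.FiniteType k B] : IsN1 B := by
  obtain ⟨s, g, hg, hfin⟩ := exists_finite_inj_algHom_of_fg k B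
  let : Algebra (MvPolynomial (Fin s) k) B := g.toRingHom.toAlgebra
  have : IsScalarTower k (MvPolynomial (Fin s) k) B :=
    IsScalarTower.of_algebraMap_eq fun a => (g.commutes a).symm
  have : FaithfulSMul (MvPolynomial (Fin s) k) B := (faithfulSMul_iff_algebraMap_injective _ _).2 hg
  have : Module.Finite (MvPolynomial (Fin s) k) B := hfin
  refine finite_integralClosure_of_forall_isMaximal fun q hq => ⟨1, q.one_notMem, ?_⟩
  exact ((IsN2.of_field k).mvPolynomial s).exists_finset_forall_pow_smul_mem_span one_ne_zero
    isIntegral_one fun b => ⟨0, Algebra.IsIntegral.isIntegral _⟩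

/-- Generic Noether normalization: a finite type extension of domains `A → B` contains a polynomial
ring over which all elements of `B` are integral after multiplication by nonzero elements of `A`. -/
theorem exists_injective_algHom_forall_exists_smul_isIntegral (A B : Type u) [CommRing A]
    [IsDomain A] [CommRing B] [IsDomain B] [Algebra A B] [FaithfulSMul A B]
    [Algebra.FiniteType A B] :
    ∃ (s : ℕ) (g : MvPolynomial (Fin s) A →ₐ[A] B), Function.Injective g ∧
      ∀ b : B, ∃ a : A, a ≠ 0 ∧ g.toRingHom.IsIntegralElem (algebraMap A B a * b) := by
  let F := FractionRing A
  let BF := TensorProduct A F B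
  let ι : B →ₐ[A] BF := Algebra.TensorProduct.includeRight
  let : Algebra B BF := Algebra.TensorProduct.rightAlgebra
  let N := Algebra.algebraMapSubmonoid B (nonZeroDivisors A)
  have hN : N ≤ nonZeroDivisors B := by
    rintro _ ⟨a, ha, rfl⟩
    exact mem_nonZeroDivisors_of_ne_zero
      ((map_ne_zero_iff _ (FaithfulSMul.algebraMap_injective A B)).2 (nonZeroDivisors.ne_zero ha))
  have : IsLocalization N BF := IsLocalization.tensorRight F (nonZeroDivisors A)
  have hι : Function.Injective ι := IsLocalization.injective BF hN
  have : Nontrivial BF := hι.nontrivial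
  obtain ⟨s, g, hg, hgfin⟩ := exists_finite_inj_algHom_of_fg F BF
  obtain ⟨c, hab⟩ := IsLocalization.exist_integer_multiples_of_finite N (fun i => g (X i))
  obtain ⟨a, ha, hac⟩ := c.2
  choose b hb using hab
  have hb' : ∀ i, ι (b i) = algebraMap F BF (algebraMap A F a) * g (X i) := by
    intro i
    refine (hb i).trans ((Algebra.smul_def (c : B) (g (X i))).trans ?_)
    rw [← hac, ← IsScalarTower.algebraMap_apply A F BF]
    congr 1
    exact ι.commutes a
  have haF : algebraMap A F a ≠ 0 :=
    (map_ne_zero_iff _ (IsFractionRing.injective A F)).2 (nonZeroDivisors.ne_zero ha)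
  -- Scaling the variables by a common denominator moves the normalizing variables into `B` and is
  -- invertible over `F`, so finiteness survives.
  let e1 : MvPolynomial (Fin s) F →ₐ[F] MvPolynomial (Fin s) F :=
    aeval fun i => C (algebraMap A F a) * X i
  let e2 : MvPolynomial (Fin s) F →ₐ[F] MvPolynomial (Fin s) F :=
    aeval fun i => C (algebraMap A F a)⁻¹ * X i
  have h12 : ∀ p, e1 (e2 p) = p := by
    intro p
    have : e1.comp e2 = AlgHom.id F _ := by
      ext i : 1
      simp only [e1, e2, AlgHom.comp_apply, aeval_X, map_mul, algHom_C, algebraMap_eq, AlgHom.id_apply]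
      rw [← mul_assoc, ← C_mul, inv_mul_cancel₀ haF, C_1, one_mul]
    exact DFunLike.congr_fun this p
  have h21 : ∀ p, e2 (e1 p) = p := by
    intro p
    have : e2.comp e1 = AlgHom.id F _ := by
      ext i : 1
      simp only [e1, e2, AlgHom.comp_apply, aeval_X, map_mul, algHom_C, algebraMap_eq, AlgHom.id_apply]
      rw [← mul_assoc, ← C_mul, mul_inv_cancel₀ haF, C_1, one_mul]
    exact DFunLike.congr_fun this p
  let g' : MvPolynomial (Fin s) F →ₐ[F] BF := g.comp e1
  have hg' : Function.Injective g' := hg.comp (Function.LeftInverse.injective h21)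
  have hg'int : ∀ z : BF, g'.toRingHom.IsIntegralElem z := by
    intro z
    obtain ⟨p, hp, hpz⟩ := hgfin.to_isIntegral z
    refine ⟨p.map e2.toRingHom, hp.map _, ?_⟩
    have hcomp : g'.toRingHom.comp e2.toRingHom = g.toRingHom :=
      RingHom.ext fun p => congrArg g (h12 p)
    rw [Polynomial.eval₂_map, hcomp]
    exact hpz
  let h : MvPolynomial (Fin s) A →ₐ[A] B := aeval b
  let : Algebra (MvPolynomial (Fin s) A) (MvPolynomial (Fin s) F) := MvPolynomial.algebraMvPolynomial
  have hcomp : ∀ p, ι (h p) = g' (MvPolynomial.map (algebraMap A F) p) := by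
    intro p
    induction p using MvPolynomial.induction_on with
    | C r =>
      have h1 : h (C r) = algebraMap A B r := by simp [h]
      have h2 : g' (C (algebraMap A F r)) = algebraMap F BF (algebraMap A F r) := g'.commutes _
      rw [h1, map_C, h2, ι.commutes, ← IsScalarTower.algebraMap_apply A F BF]
    | add p q hp hq => simp only [map_add, hp, hq]
    | mul_X p i hp =>
      simp only [map_mul, hp, map_X]
      congr 1
      have h1 : h (X i) = b i := by simp [h]
      have h2 : g' (X i) = g (C (algebraMap A F a) * X i) := by simp [g', e1]
      rw [h1, hb', h2, map_mul]
      congr 1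
      exact (g.commutes _).symm
  refine ⟨s, h, ?_, fun z => ?_⟩
  · intro p q hpq
    have := congrArg ι hpq
    rw [hcomp, hcomp] at this
    exact MvPolynomial.map_injective _ (IsFractionRing.injective A F) (hg' this)
  · let : Algebra (MvPolynomial (Fin s) F) BF := g'.toRingHom.toAlgebra
    let : Algebra (MvPolynomial (Fin s) A) B := h.toRingHom.toAlgebra
    let : Algebra (MvPolynomial (Fin s) A) BF := (ι.toRingHom.comp h.toRingHom).toAlgebra
    have : IsScalarTower (MvPolynomial (Fin s) A) (MvPolynomial (Fin s) F) BF :=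
      IsScalarTower.of_algebraMap_eq hcomp
    have : IsScalarTower (MvPolynomial (Fin s) A) B BF :=
      IsScalarTower.of_algebraMap_eq fun _ => rfl
    have hz : IsIntegral (MvPolynomial (Fin s) F) (algebraMap B BF z) := hg'int _
    obtain ⟨⟨_, c, hc, rfl⟩, hm⟩ := IsIntegral.exists_multiple_integral_of_isLocalization
      ((nonZeroDivisors A).map (C : A →+* MvPolynomial (Fin s) A)) _ hz
    refine ⟨c, nonZeroDivisors.ne_zero hc, ?_⟩
    have hmul : (C c : MvPolynomial (Fin s) A) • algebraMap B BF z =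
        algebraMap B BF (algebraMap A B c * z) := by
      rw [Algebra.smul_def, map_mul, IsScalarTower.algebraMap_apply (MvPolynomial (Fin s) A) B BF]
      congr 2
      exact h.commutes c
    rw [Submonoid.smul_def] at hm
    change IsIntegral _ ((C c : MvPolynomial (Fin s) A) • algebraMap B BF z) at hm
    rw [hmul] at hm
    exact (isIntegral_algebraMap_iff hι).1 hm

/-- Let `A` be a discrete valuation ring with uniformizer `π` and let `B` be a finite type
extension of `A`. At every prime containing `π`, the ring `B` is quasi-finite over some polynomial
ring that it contains. -/
theorem exists_injective_algHom_forall_zariskisMainProperty (A B : Type u) [CommRing A]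
    [IsDomain A] [IsDiscreteValuationRing A] [CommRing B] [IsDomain B] [Algebra A B]
    [FaithfulSMul A B] [Algebra.FiniteType A B] {π : A} (hπ : Irreducible π)
    (hB : ¬ IsUnit (algebraMap A B π)) :
    ∃ (s : ℕ) (g : MvPolynomial (Fin s) A →ₐ[A] B), Function.Injective g ∧
      ∀ q : Ideal B, q.IsPrime → algebraMap A B π ∈ q →
        ∃ r ∉ q, g.toRingHom.IsIntegralElem r ∧ ∀ b, ∃ m, g.toRingHom.IsIntegralElem (r ^ m * b) := by
  let p : Ideal A := Ideal.span {π}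
  have hpmax : p.IsMaximal := PrincipalIdealRing.isMaximal_of_irreducible hπ
  let : Field (A ⧸ p) := Ideal.Quotient.field p
  let I : Ideal B := p.map (algebraMap A B)
  have hI : I = Ideal.span {algebraMap A B π} := by
    simp only [I, p, Ideal.map_span, Set.image_singleton]
  have hItop : I ≠ ⊤ := by rwa [hI, Ne, Ideal.span_singleton_eq_top]
  have : Nontrivial (B ⧸ I) := Ideal.Quotient.nontrivial_iff.2 hItop
  have : Algebra.FiniteType (A ⧸ p) (B ⧸ I) := Algebra.FiniteType.of_restrictScalars_finiteType A _ _
  obtain ⟨s, g, hg, hgfin⟩ := exists_finite_inj_algHom_of_fg (A ⧸ p) (B ⧸ I)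
  -- The polynomial ring is a lift of a Noether normalization of `B / πB` over the residue field.
  choose b hb using fun i => Ideal.Quotient.mk_surjective (g (X i))
  let h : MvPolynomial (Fin s) A →ₐ[A] B := aeval b
  have hcomp : ∀ f, Ideal.Quotient.mk I (h f) = g (MvPolynomial.map (Ideal.Quotient.mk p) f) := by
    intro f
    induction f using MvPolynomial.induction_on with
    | C r =>
      have h1 : h (C r) = algebraMap A B r := by simp [h]
      rw [h1, map_C]
      exact (g.commutes (Ideal.Quotient.mk p r)).symm
    | add p q hp hq => simp only [map_add, hp, hq]
    | mul_X p i hp => simp only [map_mul, hp, map_X, ← hb]; simp [h]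
  refine ⟨s, h, ?_, fun q hq hπq => ?_⟩
  · rw [injective_iff_map_eq_zero]
    intro f hf
    by_contra hf0
    have hCπ : ¬ IsUnit (C π : MvPolynomial (Fin s) A) := fun hu =>
      hπ.not_isUnit (by simpa using hu.map (constantCoeff (σ := Fin s) (R := A)))
    -- Once the powers of `π` are divided out, a relation would reduce to a nonzero relation modulo
    -- `π`.
    obtain ⟨n, f', hf', rfl⟩ := WfDvdMonoid.max_power_factor' hf0 hCπ
    have h1 : h f' = 0 := by
      have hC : h (C π) = algebraMap A B π := by simp [h]
      rw [map_mul, map_pow, hC] at hf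
      refine (mul_eq_zero.1 hf).resolve_left (pow_ne_zero _ ?_)
      exact (map_ne_zero_iff _ (FaithfulSMul.algebraMap_injective A B)).2 hπ.ne_zero
    refine hf' ((C_dvd_iff_map_hom_eq_zero (Ideal.Quotient.mk p) π (fun r => ?_) f').2 ?_)
    · rw [Ideal.Quotient.eq_zero_iff_mem, Ideal.mem_span_singleton]
    · apply hg
      rw [← hcomp, h1, map_zero, map_zero]
  · let : Algebra (MvPolynomial (Fin s) A) B := h.toRingHom.toAlgebra
    have : IsScalarTower A (MvPolynomial (Fin s) A) B :=
      IsScalarTower.of_algebraMap_eq fun a => (h.commutes a).symm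
    have : Algebra.FiniteType (MvPolynomial (Fin s) A) B :=
      Algebra.FiniteType.of_restrictScalars_finiteType A _ _
    have hfin : Module.Finite (MvPolynomial (Fin s) A) (B ⧸ I) := by
      have h2 : (g.toRingHom.comp (MvPolynomial.map (Ideal.Quotient.mk p))).Finite :=
        RingHom.Finite.comp hgfin (RingHom.Finite.of_surjective _
          (MvPolynomial.map_surjective _ Ideal.Quotient.mk_surjective))
      have h3 : algebraMap (MvPolynomial (Fin s) A) (B ⧸ I) =
          g.toRingHom.comp (MvPolynomial.map (Ideal.Quotient.mk p)) := 
        RingHom.ext hcomp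
      rw [← RingHom.finite_algebraMap, h3]
      exact h2
    -- Since `π ∈ q`, the quotient `B ⧸ I0` is a quotient of `B / πB`, which is finite over the
    -- polynomial ring. So `B` is quasi-finite at `q` and Zariski's main theorem applies.
    let I0 : Ideal B := (q.under (MvPolynomial (Fin s) A)).map (algebraMap (MvPolynomial (Fin s) A) B)
    have hI0 : I ≤ I0 := by
      rw [hI, Ideal.span_singleton_le_iff_mem]
      have : algebraMap A B π = algebraMap (MvPolynomial (Fin s) A) B (C π) :=
        IsScalarTower.algebraMap_apply A (MvPolynomial (Fin s) A) B π
      rw [this]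
      refine Ideal.mem_map_of_mem _ ?_
      rw [Ideal.mem_comap, ← this]
      exact hπq
    have : Algebra.QuasiFinite (MvPolynomial (Fin s) A) (B ⧸ I0) :=
      Algebra.QuasiFinite.of_surjective_algHom (S := B ⧸ I)
        (Ideal.Quotient.factorₐ _ hI0) (Ideal.Quotient.factor_surjective hI0)
    have : Algebra.WeaklyQuasiFiniteAt (MvPolynomial (Fin s) A) q := by
      infer_instance
    exact Algebra.zariskisMainProperty_iff.1
      (Algebra.ZariskisMainProperty.of_finiteType_of_weaklyQuasiFiniteAt q)

/-- A discrete valuation ring that is N-2 is universally Japanese. -/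
theorem IsN2.isUniversallyJapanese {A : Type u} [CommRing A] [IsDomain A]
    [IsDiscreteValuationRing A] (hA : IsN2 A) : IsUniversallyJapanese A := by
  intro B _ _ _ _
  obtain ⟨π, hπ⟩ := IsDiscreteValuationRing.exists_irreducible A
  by_cases hinj : Function.Injective (algebraMap A B)
  · have : FaithfulSMul A B := (faithfulSMul_iff_algebraMap_injective _ _).2 hinj
    refine finite_integralClosure_of_forall_isMaximal fun q hq => ?_
    by_cases hπq : algebraMap A B π ∈ q
    · obtain ⟨s, g, hg, h⟩ := exists_injective_algHom_forall_zariskisMainProperty A B hπ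
        (fun h => hq.ne_top (Ideal.eq_top_of_isUnit_mem q hπq h))
      obtain ⟨r, hrq, hr, hrb⟩ := h q hq.isPrime hπq
      let : Algebra (MvPolynomial (Fin s) A) B := g.toRingHom.toAlgebra
      have : IsScalarTower A (MvPolynomial (Fin s) A) B :=
        IsScalarTower.of_algebraMap_eq fun a => (g.commutes a).symm
      have : Algebra.FiniteType (MvPolynomial (Fin s) A) B :=
        Algebra.FiniteType.of_restrictScalars_finiteType A _ _
      have : FaithfulSMul (MvPolynomial (Fin s) A) B :=
        (faithfulSMul_iff_algebraMap_injective _ _).2 hg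
      refine ⟨r, hrq, (hA.mvPolynomial s).exists_finset_forall_pow_smul_mem_span ?_ hr hrb⟩
      rintro rfl
      exact hrq q.zero_mem
    -- Away from `π`, the multipliers of generic Noether normalization are units times powers of
    -- `π`, so `r = π` works.
    · obtain ⟨s, g, hg, h⟩ := exists_injective_algHom_forall_exists_smul_isIntegral A B
      let : Algebra (MvPolynomial (Fin s) A) B := g.toRingHom.toAlgebra
      have : IsScalarTower A (MvPolynomial (Fin s) A) B :=
        IsScalarTower.of_algebraMap_eq fun a => (g.commutes a).symm
      have : Algebra.FiniteType (MvPolynomial (Fin s) A) B :=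
        Algebra.FiniteType.of_restrictScalars_finiteType A _ _
      have : FaithfulSMul (MvPolynomial (Fin s) A) B :=
        (faithfulSMul_iff_algebraMap_injective _ _).2 hg
      refine ⟨algebraMap A B π, hπq, (hA.mvPolynomial s).exists_finset_forall_pow_smul_mem_span
        ((map_ne_zero_iff _ hinj).2 hπ.ne_zero) ?_ fun b => ?_⟩
      · rw [IsScalarTower.algebraMap_apply A (MvPolynomial (Fin s) A) B]
        exact isIntegral_algebraMap
      · obtain ⟨a, ha, hab⟩ := h b
        obtain ⟨m, u, rfl⟩ := IsDiscreteValuationRing.eq_unit_mul_pow_irreducible ha hπ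
        refine ⟨m, ?_⟩
        have h1 : algebraMap A B π ^ m * b = algebraMap (MvPolynomial (Fin s) A) B
            (algebraMap A (MvPolynomial (Fin s) A) (↑u⁻¹ : A)) *
            (algebraMap A B (u * π ^ m) * b) := by
          rw [← IsScalarTower.algebraMap_apply A (MvPolynomial (Fin s) A) B, ← mul_assoc, ← map_mul,
            Units.inv_mul_cancel_left, map_pow]
        rw [h1]
        exact isIntegral_algebraMap.mul hab
  -- A nonzero kernel is the maximal ideal, and `B` is then of finite type over the residue field.
  · have hker : RingHom.ker (algebraMap A B) ≠ ⊥ := by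
      rwa [Ne, ← RingHom.injective_iff_ker_eq_bot]
    have hprime : (RingHom.ker (algebraMap A B)).IsPrime := RingHom.ker_isPrime _
    have hmax : (RingHom.ker (algebraMap A B)).IsMaximal := hprime.isMaximal hker
    let k := A ⧸ RingHom.ker (algebraMap A B)
    let : Field k := Ideal.Quotient.field _
    let : Algebra k B := (RingHom.kerLift (algebraMap A B)).toAlgebra
    have : IsScalarTower A k B := IsScalarTower.of_algebraMap_eq fun _ => rfl
    have : Algebra.FiniteType k B := Algebra.FiniteType.of_restrictScalars_finiteType A _ _
    exact IsN1.of_finiteType_field k B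

end UniversallyJapanese

/-! ### Local rings mapping to a field, with units detected by a residue map -/

theorem AlgebraicIndependent.update {R : Type u} {A : Type v} {ι : Type w} [CommRing R]
    [CommRing A] [Algebra R A] [DecidableEq ι] {g : ι → A} (hg : AlgebraicIndependent R g) (j : ι)
    {t : A} (h : IsAlgebraic (Algebra.adjoin R (g '' {j}ᶜ)) t →
      IsAlgebraic (Algebra.adjoin R (g '' {j}ᶜ)) (g j)) :
    AlgebraicIndependent R (Function.update g j t) := by
  rw [AlgebraicIndependent.iff_transcendental_adjoin_image j] at hg ⊢
  have himage : Function.update g j t '' {j}ᶜ = g '' {j}ᶜ :=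
    Set.image_congr fun k hk => Function.update_of_ne hk _ _
  refine ⟨?_, ?_⟩
  · convert hg.1 using 2 with k
    exact Function.update_of_ne k.2 _ _
  · rw [himage, Function.update_self]
    exact fun ht => hg.2 (h ht)

/-- Let `G` be a local ring with a map `ψ` to a field `K`, whose units are detected by a map `ρ` to
a field. Let the `V`-algebra `A` in `K` be generated by an element `ψ p` that divides `x`, and by
elements whose images under `ρ` are algebraically independent over the residue field `V / x`. Then
the elements of `A` are divisible by `ψ p` or are images of units of `G`. -/
theorem eq_mul_or_inv_mem_range {V K κ F G τ : Type*} [CommRing V] [Field K] [Algebra V K] [Field κ]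
    [Field F] [Algebra κ F] [CommRing G] [Algebra V G] (ψ : G →ₐ[V] K) (ρ : G →+* F) (q : V →+* κ)
    {x : V} (hq : ∀ a, q a = 0 ↔ x ∣ a) (hρ : ∀ a, ρ (algebraMap V G a) = algebraMap κ F (q a))
    (hunit : ∀ g, ρ g ≠ 0 → IsUnit g) {p : G} (hp : ρ p = 0) {g : τ → G}
    (hg : AlgebraicIndependent κ fun i => ρ (g i)) {A : Subalgebra V K}
    (hA : A = Algebra.adjoin V (insert (ψ p) (Set.range fun i => ψ (g i))))
    (hx : ∃ r ∈ A, algebraMap V K x = ψ p * r) {f : K} (hf : f ∈ A) :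
    (∃ r ∈ A, f = ψ p * r) ∨ (f ≠ 0 ∧ f⁻¹ ∈ ψ.range) := by
  let B := Algebra.adjoin V (Set.range fun i => ψ (g i))
  have hpA : ψ p ∈ A := hA ▸ Algebra.subset_adjoin (Set.mem_insert _ _)
  have hBA : B ≤ A := hA ▸ Algebra.adjoin_mono (Set.subset_insert _ _)
  -- Modulo `ψ p` every element of `A` is a polynomial over `V` in the remaining generators.
  have hdec : ∀ f ∈ A, ∃ r ∈ A, ∃ b ∈ B, f = ψ p * r + b := by
    intro f hf
    rw [hA] at hf
    induction hf using Algebra.adjoin_induction with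
    | mem f hf =>
      rcases hf with rfl | hf
      · exact ⟨1, one_mem _, 0, zero_mem _, by ring⟩
      · exact ⟨0, zero_mem _, f, Algebra.subset_adjoin hf, by ring⟩
    | algebraMap a => exact ⟨0, zero_mem _, _, B.algebraMap_mem a, by ring⟩
    | add f f' _ _ hf hf' =>
      obtain ⟨r, hr, b, hb, rfl⟩ := hf
      obtain ⟨r', hr', b', hb', rfl⟩ := hf'
      exact ⟨r + r', add_mem hr hr', b + b', add_mem hb hb', by ring⟩
    | mul f f' _ _ hf hf' =>
      obtain ⟨r, hr, b, hb, rfl⟩ := hf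
      obtain ⟨r', hr', b', hb', rfl⟩ := hf'
      exact ⟨ψ p * r * r' + r * b' + r' * b, add_mem (add_mem (mul_mem (mul_mem hpA hr) hr')
        (mul_mem hr (hBA hb'))) (mul_mem hr' (hBA hb)), b * b', mul_mem hb hb', by ring⟩
  obtain ⟨r, hr, b, hb, rfl⟩ := hdec f hf
  obtain ⟨H, rfl⟩ : b ∈ (MvPolynomial.aeval (R := V) fun i => ψ (g i)).range := by
    rwa [← Algebra.adjoin_range_eq_range_aeval]
  have hψ : ψ (MvPolynomial.aeval g H) = MvPolynomial.aeval (fun i => ψ (g i)) H :=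
    MvPolynomial.comp_aeval_apply g ψ H
  have hρH : ρ (MvPolynomial.aeval g H) =
      MvPolynomial.aeval (fun i => ρ (g i)) (MvPolynomial.map q H) := by
    rw [MvPolynomial.aeval_def, MvPolynomial.aeval_def, MvPolynomial.eval₂_map,
      MvPolynomial.hom_eval₂]
    congr 1
    ext a
    exact hρ a
  have hAψ : A ≤ ψ.range := by
    rw [hA, Algebra.adjoin_le_iff]
    rintro _ (rfl | ⟨i, rfl⟩) <;> exact ⟨_, rfl⟩
  obtain ⟨r', rfl⟩ := hAψ hr
  change (∃ s ∈ A, ψ p * ψ r' + MvPolynomial.aeval (fun i => ψ (g i)) H = ψ p * s) ∨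
    (ψ p * ψ r' + MvPolynomial.aeval (fun i => ψ (g i)) H ≠ 0 ∧
      (ψ p * ψ r' + MvPolynomial.aeval (fun i => ψ (g i)) H)⁻¹ ∈ ψ.range)
  -- If the residue vanishes, algebraic independence makes `x` divide all coefficients of `H`, and
  -- `ψ p` divides `x`. Otherwise the whole element lifts to a unit of `G`.
  by_cases h0 : ρ (MvPolynomial.aeval g H) = 0
  · left
    obtain ⟨H', rfl⟩ := (MvPolynomial.C_dvd_iff_map_hom_eq_zero q x hq H).2
      (hg ((hρH.symm.trans h0).trans (map_zero _).symm))
    obtain ⟨s, hs, hxs⟩ := hx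
    refine ⟨ψ r' + s * MvPolynomial.aeval (fun i => ψ (g i)) H',
      add_mem hr (mul_mem hs (hBA ?_)), ?_⟩
    · change _ ∈ Algebra.adjoin V _
      rw [Algebra.adjoin_range_eq_range_aeval]
      exact ⟨H', rfl⟩
    · rw [map_mul, MvPolynomial.aeval_C, hxs]
      ring
  · right
    obtain ⟨w, hw⟩ := hunit (p * r' + MvPolynomial.aeval g H) (by simpa [hp] using h0)
    rw [← hψ, ← map_mul, ← map_add, ← hw]
    have hinv : ψ w * ψ ↑w⁻¹ = 1 := by rw [← map_mul, Units.mul_inv, map_one]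
    exact ⟨left_ne_zero_of_mul_eq_one hinv, ↑w⁻¹, eq_inv_of_mul_eq_one_right hinv⟩

/-- If `ψ w` were the inverse of `ψ p`, then `1 - p * w` would have residue `1`, hence be a unit,
and yet be killed by `ψ`. -/
theorem inv_notMem_range {V K F G : Type*} [CommRing V] [Field K] [Algebra V K]
    [Field F] [CommRing G] [Algebra V G] (ψ : G →ₐ[V] K) (ρ : G →+* F)
    (hunit : ∀ g, ρ g ≠ 0 → IsUnit g) {p : G} (hp : ρ p = 0) (hp0 : ψ p ≠ 0) :
    (ψ p)⁻¹ ∉ ψ.range := by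
  rintro ⟨w, hw⟩
  obtain ⟨u, hu⟩ := hunit (1 - p * w) (by simp [hp])
  have h := (u.isUnit.map ψ).ne_zero
  change ψ w = _ at hw
  rw [hu, map_sub, map_mul, hw, map_one, mul_inv_cancel₀ hp0, sub_self] at h
  exact h rfl

/-- Take `G' = G[T] / (T² - c)` with the root `θ` sent to residue `0`, which is possible as `ρ c =
0`. This passes from a Gauss ring to the ring of the place `some j`; the extension is ramified, so
the residue field does not change. -/
theorem exists_sqrt_extension {V K F : Type*} {G : Type u} [CommRing V] [Field K] [Algebra V K]
    [Field F] [CommRing G] [Algebra V G] (ψ : G →ₐ[V] K) (ρ : G →+* F)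
    (hunit : ∀ g, ρ g ≠ 0 → IsUnit g) {c : G} (hc : ρ c = 0) {z : K} (hz : z ^ 2 = ψ c) :
    ∃ (G' : Type u) (_ : CommRing G') (_ : Algebra V G') (ι : G →ₐ[V] G') (ψ' : G' →ₐ[V] K)
      (ρ' : G' →+* F) (θ : G'), ι.toRingHom.Finite ∧ (∀ g, ψ' (ι g) = ψ g) ∧
      (∀ g, ρ' (ι g) = ρ g) ∧ ρ' θ = 0 ∧ ψ' θ = z ∧ ∀ g, ρ' g ≠ 0 → IsUnit g := by
  let f : Polynomial G := Polynomial.X ^ 2 - Polynomial.C c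
  have hf : f.Monic := Polynomial.monic_X_pow_sub_C c two_ne_zero
  have hroot : AdjoinRoot.root f ^ 2 = AdjoinRoot.of f c := by
    have h := AdjoinRoot.eval₂_root f
    rwa [Polynomial.eval₂_sub, Polynomial.eval₂_X_pow, Polynomial.eval₂_C, sub_eq_zero] at h
  have hdec : ∀ g : AdjoinRoot f, ∃ a b, g = AdjoinRoot.of f a + AdjoinRoot.of f b *
      AdjoinRoot.root f := by
    intro g
    obtain ⟨p, rfl⟩ := AdjoinRoot.mk_surjective g
    induction p using Polynomial.induction_on with
    | C a => exact ⟨a, 0, by simp⟩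
    | add p q hp hq =>
      obtain ⟨a, b, h⟩ := hp
      obtain ⟨a', b', h'⟩ := hq
      exact ⟨a + a', b + b', by rw [map_add, h, h', map_add, map_add]; ring⟩
    | monomial n a h =>
      obtain ⟨a', b, h⟩ := h
      refine ⟨b * c, a', ?_⟩
      rw [pow_succ, ← mul_assoc, map_mul, h, AdjoinRoot.mk_X, map_mul, ← hroot]
      ring
  have hψ : Polynomial.eval₂ (ψ : G →+* K) z f = 0 := by
    rw [Polynomial.eval₂_sub, Polynomial.eval₂_X_pow, Polynomial.eval₂_C, hz]
    exact sub_self _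
  have hρ : Polynomial.eval₂ ρ 0 f = 0 := by
    rw [Polynomial.eval₂_sub, Polynomial.eval₂_X_pow, Polynomial.eval₂_C, hc]
    simp
  refine ⟨AdjoinRoot f, inferInstance, inferInstance, IsScalarTower.toAlgHom V G (AdjoinRoot f),
    AdjoinRoot.liftAlgHom f ψ z hψ, AdjoinRoot.lift ρ 0 hρ, AdjoinRoot.root f, ?_, fun g => ?_,
    fun g => ?_, ?_, ?_, fun g hg => ?_⟩
  · exact RingHom.finite_algebraMap.2 hf.finite_adjoinRoot
  · exact AdjoinRoot.liftAlgHom_of f ψ z hψ g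
  · exact AdjoinRoot.lift_of hρ
  · exact AdjoinRoot.lift_root hρ
  · exact AdjoinRoot.liftAlgHom_root f ψ z hψ
  · obtain ⟨a, b, rfl⟩ := hdec g
    rw [map_add, map_mul, AdjoinRoot.lift_root, mul_zero, add_zero, AdjoinRoot.lift_of] at hg
    -- The norm of `a + b θ` has the residue of `a ^ 2`, so it is a unit.
    have h : IsUnit (a ^ 2 - b ^ 2 * c) := hunit _ (by simpa [hc] using hg)
    refine isUnit_of_mul_isUnit_left (y := AdjoinRoot.of f a - AdjoinRoot.of f b *
      AdjoinRoot.root f) ?_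
    convert h.map (AdjoinRoot.of f) using 1
    rw [map_sub, map_mul, map_pow, map_pow, ← hroot]
    ring

theorem exists_inv_lift {V K F G : Type*} [CommRing V] [Field K] [Algebra V K]
    [Field F] [CommRing G] [Algebra V G] (ψ : G →ₐ[V] K) (ρ : G →+* F)
    (hunit : ∀ g, ρ g ≠ 0 → IsUnit g) {g : G} (hg : ρ g ≠ 0) :
    ∃ u, ρ u = (ρ g)⁻¹ ∧ ψ u = (ψ g)⁻¹ := by
  obtain ⟨w, rfl⟩ := hunit g hg
  refine ⟨↑w⁻¹, eq_inv_of_mul_eq_one_right ?_, eq_inv_of_mul_eq_one_right ?_⟩ <;>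
  rw [← map_mul, Units.mul_inv, map_one]

/-! ### The Gauss ring and its embeddings -/

namespace AlmostDedekindExample

section GaussRing

variable (V : Type u) [CommRing V] [IsLocalRing V]

/-- The polynomials over `V` whose coefficients are in the maximal ideal. -/
noncomputable abbrev gaussIdeal : Ideal (MvPolynomial ℕ V) :=
  RingHom.ker (MvPolynomial.map (IsLocalRing.residue V))

instance : (gaussIdeal V).IsPrime := RingHom.ker_isPrime _

/-- The local ring of the Gauss extension of the maximal ideal to the field of rational functions. -/
abbrev Gauss : Type u := Localization.AtPrime (gaussIdeal V)

theorem exists_gauss_residue : ∃ ρ : Gauss V →+*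
    FractionRing (MvPolynomial ℕ (IsLocalRing.ResidueField V)),
    (∀ f, ρ (algebraMap (MvPolynomial ℕ V) (Gauss V) f) =
      algebraMap _ _ (MvPolynomial.map (IsLocalRing.residue V) f)) ∧
    ∀ g, ρ g ≠ 0 → IsUnit g := by
  have hu : ∀ s : (gaussIdeal V).primeCompl, IsUnit (((algebraMap (MvPolynomial ℕ _) (FractionRing
      (MvPolynomial ℕ (IsLocalRing.ResidueField V)))).comp (MvPolynomial.map (IsLocalRing.residue V))) s) := by
    intro s
    rw [isUnit_iff_ne_zero, RingHom.comp_apply]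
    exact (map_ne_zero_iff _ (IsFractionRing.injective _ _)).2 s.2
  refine ⟨IsLocalization.lift hu, fun f => IsLocalization.lift_eq hu f, fun g hg => ?_⟩
  obtain ⟨f, s, rfl⟩ := IsLocalization.exists_mk'_eq (gaussIdeal V).primeCompl g
  rw [IsLocalization.AtPrime.isUnit_mk'_iff _ (gaussIdeal V)]
  intro hf
  rw [IsLocalization.lift_mk', RingHom.comp_apply, (RingHom.mem_ker).1 hf] at hg
  simp at hg

variable {V}

/-- The embedding of the polynomial ring is left arbitrary because each place puts the Gauss ring
into the ambient field in different coordinates. -/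
theorem exists_gauss_algHom {K : Type*} [Field K] [Algebra V K] (φ : MvPolynomial ℕ V →ₐ[V] K)
    (hφ : Function.Injective φ) : ∃ ψ : Gauss V →ₐ[V] K,
      (∀ f, ψ (algebraMap (MvPolynomial ℕ V) (Gauss V) f) = φ f) ∧ Function.Injective ψ := by
  have hu : ∀ s : (gaussIdeal V).primeCompl, IsUnit (φ s) := fun s =>
    isUnit_iff_ne_zero.2 ((map_ne_zero_iff _ hφ).2 fun h => s.2 (h ▸ zero_mem _))
  have hlift : ∀ f, IsLocalization.liftAlgHom (S := Gauss V) hu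
      (algebraMap (MvPolynomial ℕ V) (Gauss V) f) = φ f := fun f => IsLocalization.lift_eq hu f
  refine ⟨IsLocalization.liftAlgHom hu, hlift, ?_⟩
  rw [injective_iff_map_eq_zero]
  intro g hg
  obtain ⟨f, s, rfl⟩ := IsLocalization.exists_mk'_eq (gaussIdeal V).primeCompl g
  have h := congrArg (IsLocalization.liftAlgHom (S := Gauss V) hu)
    (IsLocalization.mk'_spec (Gauss V) f s)
  rw [map_mul, hg, zero_mul, hlift, eq_comm, map_eq_zero_iff _ hφ] at h
  rw [h, IsLocalization.mk'_zero]

end GaussRing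

/-! ### Construction of the places `none` and `some j` -/

section Places

variable {V : Type u} [CommRing V]

theorem algebraicIndependent_y : AlgebraicIndependent V (y V) :=
  (MvPolynomial.algebraicIndependent_X ℕ V).map'
    (f := IsScalarTower.toAlgHom V (MvPolynomial ℕ V) (Amb V)) (IsFractionRing.injective _ _)

theorem algebraMap_injective_amb : Function.Injective (algebraMap V (Amb V)) := by
  rw [IsScalarTower.algebraMap_eq V (MvPolynomial ℕ V) (Amb V)]
  exact (IsFractionRing.injective (MvPolynomial ℕ V) (Amb V)).comp (MvPolynomial.C_injective ℕ V)

variable [IsDomain V]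

/-- The generator of the ideal that the place `b` cuts out on `Rᵢ`: the place `none` is centered
at `xᵢ`, and the place `some j` is centered at `yⱼ` as soon as `yⱼ` lies in `Rᵢ`, and at `xᵢ`
before. -/
noncomputable def gen (x : V) (b : Option ℕ) (i : ℕ) : Amb V :=
  b.elim (xs x i) fun j => if j < i then y V j else xs x i

/-- The defining properties of the valuation ring of the place `b` of `D`. -/
structure IsPlace (x : V) (b : Option ℕ) (O : Subalgebra V (Amb V)) : Prop where
  R_le : ∀ i, R x i ≤ O
  y_inv_mem : ∀ k, b ≠ some k → (y V k)⁻¹ ∈ O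
  gen_inv_notMem : ∀ i, (gen x b i)⁻¹ ∉ O
  eq_mul_or_inv_mem : ∀ i, ∀ f ∈ R x i,
    (∃ r ∈ R x i, f = gen x b i * r) ∨ (f ≠ 0 ∧ f⁻¹ ∈ O)

theorem y_ne_zero (j : ℕ) : y V j ≠ 0 :=
  (map_ne_zero_iff _ (IsFractionRing.injective _ _)).2 (MvPolynomial.X_ne_zero j)

theorem xs_eq (x : V) (i : ℕ) :
    xs x i = algebraMap V (Amb V) x * (∏ k ∈ Finset.range i, y V k ^ 2)⁻¹ := by
  induction i with
  | zero => simp [xs]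
  | succ i ih => rw [xs, ih, Finset.prod_range_succ, mul_inv, div_eq_mul_inv, mul_assoc]

theorem xs_ne_zero {x : V} (hx : x ≠ 0) (i : ℕ) : xs x i ≠ 0 := by
  rw [xs_eq]
  exact mul_ne_zero ((map_ne_zero_iff _ algebraMap_injective_amb).2 hx)
    (inv_ne_zero (Finset.prod_ne_zero_iff.2 fun k _ => pow_ne_zero 2 (y_ne_zero k)))

theorem gen_ne_zero {x : V} (hx : x ≠ 0) (b : Option ℕ) (i : ℕ) : gen x b i ≠ 0 := by
  cases b with
  | none => exact xs_ne_zero hx i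
  | some j =>
    simp only [gen, Option.elim]
    split_ifs
    exacts [y_ne_zero j, xs_ne_zero hx i]

theorem xs_mem_R (x : V) (i : ℕ) : xs x i ∈ R x i :=
  Algebra.subset_adjoin (Set.mem_insert _ _)

theorem y_mem_R (x : V) {i j : ℕ} (hj : j < i) : y V j ∈ R x i :=
  Algebra.subset_adjoin (Set.mem_insert_of_mem _ ⟨j, hj, rfl⟩)

theorem gen_mem_R (x : V) (b : Option ℕ) (i : ℕ) : gen x b i ∈ R x i := by
  cases b with
  | none => exact xs_mem_R x i
  | some j =>
    simp only [gen, Option.elim]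
    split_ifs with h
    exacts [y_mem_R x h, xs_mem_R x i]

theorem algebraMap_eq_gen_mul (x : V) (b : Option ℕ) (i : ℕ) :
    ∃ r ∈ R x i, algebraMap V (Amb V) x = gen x b i * r := by
  have hy : ∏ k ∈ Finset.range i, y V k ^ 2 ∈ R x i := prod_mem fun k hk =>
    pow_mem (y_mem_R x (Finset.mem_range.1 hk)) 2
  have hx : algebraMap V (Amb V) x = xs x i * ∏ k ∈ Finset.range i, y V k ^ 2 := by
    rw [xs_eq, inv_mul_cancel_right₀]
    exact Finset.prod_ne_zero_iff.2 fun k _ => pow_ne_zero 2 (y_ne_zero k)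
  cases b with
  | none => exact ⟨_, hy, hx⟩
  | some j =>
    simp only [gen, Option.elim]
    split_ifs with h
    · refine ⟨xs x i * (y V j * ∏ k ∈ (Finset.range i).erase j, y V k ^ 2), mul_mem (xs_mem_R x i)
        (mul_mem (y_mem_R x h) (prod_mem fun k hk => pow_mem (y_mem_R x (Finset.mem_range.1
          (Finset.mem_of_mem_erase hk))) 2)), ?_⟩
      rw [hx, ← Finset.mul_prod_erase _ _ (Finset.mem_range.2 h)]
      ring
    · exact ⟨_, hy, hx⟩

/-- `yⱼ²` is the quotient of `x` by `x / yⱼ²`, so if the latter were algebraic over the other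
variables, `yⱼ` would be as well. -/
theorem algebraicIndependent_update_y {x : V} (hx : x ≠ 0) (j : ℕ) : AlgebraicIndependent V
    (Function.update (y V) j (algebraMap V (Amb V) x * (y V j ^ 2)⁻¹)) := by
  have hx' : algebraMap V (Amb V) x ≠ 0 := (map_ne_zero_iff _ algebraMap_injective_amb).2 hx
  refine algebraicIndependent_y.update j fun h => IsAlgebraic.of_pow two_pos ?_
  have hx'' : IsAlgebraic (Algebra.adjoin V (y V '' {j}ᶜ)) (algebraMap V (Amb V) x) := by
    rw [IsScalarTower.algebraMap_apply V (Algebra.adjoin V (y V '' {j}ᶜ)) (Amb V)]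
    exact isAlgebraic_algebraMap _
  convert hx''.mul h.inv using 1
  have := y_ne_zero (V := V) j
  field_simp

theorem R_eq_adjoin_range (x : V) (i : ℕ) : R x i = Algebra.adjoin V
    (insert (xs x i) (Set.range fun k : Set.Iio i => y V k)) := by
  rw [R, Set.image_eq_range]

section Local

variable {G : Type v} {F : Type w} {κ : Type*} [CommRing G] [Algebra V G] [Field κ] [Field F]
  [Algebra κ F] (ψ : G →ₐ[V] Amb V) (ρ : G →+* F) (q : V →+* κ) {x : V}
  (hq : ∀ a, q a = 0 ↔ x ∣ a) (hρ : ∀ a, ρ (algebraMap V G a) = algebraMap κ F (q a))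
  (hunit : ∀ g, ρ g ≠ 0 → IsUnit g) {g : ℕ → G} (hg : AlgebraicIndependent κ fun i => ρ (g i))
include hunit hg

theorem exists_lift_prod_inv (s : Finset ℕ) : ∃ u, ρ u = (∏ k ∈ s, ρ (g k) ^ 2)⁻¹ ∧
    ψ u = (∏ k ∈ s, ψ (g k) ^ 2)⁻¹ := by
  have h : ρ (∏ k ∈ s, g k ^ 2) ≠ 0 := by
    rw [map_prod, Finset.prod_ne_zero_iff]
    exact fun k _ => by rw [map_pow]; exact pow_ne_zero 2 (hg.ne_zero k)
  obtain ⟨u, h₁, h₂⟩ := exists_inv_lift ψ ρ hunit h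
  exact ⟨u, by simp [h₁, map_prod, map_pow], by simp [h₂, map_prod, map_pow]⟩

include hq hρ

/-- Here all `yₖ` with `k < i` are units with independent residues, so `xᵢ` is `x` times a unit.
This covers `none` at every stage and `some j` at the stages `i ≤ j`. -/
theorem place_xs {i : ℕ} (hgy : ∀ k < i, ψ (g k) = y V k) (hx0 : x ≠ 0) :
    R x i ≤ ψ.range ∧ (xs x i)⁻¹ ∉ ψ.range ∧
    ∀ f ∈ R x i, (∃ r ∈ R x i, f = xs x i * r) ∨ (f ≠ 0 ∧ f⁻¹ ∈ ψ.range) := by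
  obtain ⟨u, hρu, hψu⟩ := exists_lift_prod_inv ψ ρ hunit hg (Finset.range i)
  have hp : ρ (algebraMap V G x * u) = 0 := by
    rw [map_mul, hρ, (hq x).2 dvd_rfl, map_zero, zero_mul]
  have hψ : ψ (algebraMap V G x * u) = xs x i := by
    rw [xs_eq, map_mul, hψu, AlgHom.commutes]
    congr 2
    exact Finset.prod_congr rfl fun k hk => by rw [hgy k (Finset.mem_range.1 hk)]
  have hA : R x i = Algebra.adjoin V (insert (ψ (algebraMap V G x * u))
      (Set.range fun k : Set.Iio i => ψ (g k))) := by
    rw [R_eq_adjoin_range, hψ]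
    congr 3
    ext k
    exact (hgy k k.2).symm
  refine ⟨?_, ?_, fun f hf => ?_⟩
  · rw [hA, Algebra.adjoin_le_iff]
    rintro _ (rfl | ⟨i, rfl⟩) <;> exact ⟨_, rfl⟩
  · rw [← hψ]
    exact inv_notMem_range ψ ρ hunit hp (hψ ▸ xs_ne_zero hx0 i)
  · have h := eq_mul_or_inv_mem_range ψ ρ q hq hρ hunit hp (g := fun k : Set.Iio i => g k)
      (hg.comp _ Subtype.val_injective) hA (hψ ▸ algebraMap_eq_gen_mul x none i) hf
    rwa [hψ] at h

/-- Once `yⱼ` lies in `Rᵢ` it is the generator of residue `0`. The element `xᵢ` is a unit multiple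
of `x / yⱼ²` and takes over the role of the `j`-th generator with independent residue. -/
theorem place_y {i j : ℕ} (hj : j < i) (hgy : ∀ k ≠ j, ψ (g k) = y V k)
    (hgj : ψ (g j) = algebraMap V (Amb V) x * (y V j ^ 2)⁻¹) {θ : G} (hρθ : ρ θ = 0)
    (hψθ : ψ θ = y V j) : R x i ≤ ψ.range ∧ (y V j)⁻¹ ∉ ψ.range ∧
    ∀ f ∈ R x i, (∃ r ∈ R x i, f = y V j * r) ∨ (f ≠ 0 ∧ f⁻¹ ∈ ψ.range) := by
  obtain ⟨u, hρu, hψu⟩ := exists_lift_prod_inv ψ ρ hunit hg ((Finset.range i).erase j)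
  let g' := Function.update g j (g j * u)
  have hg'j : g' j = g j * u := Function.update_self _ _ _
  have hg' : ∀ k ≠ j, g' k = g k := fun k hk => Function.update_of_ne hk _ _
  have hψ : ψ (g' j) = xs x i := by
    rw [xs_eq, hg'j, map_mul, hψu, hgj, ← Finset.mul_prod_erase _ _ (Finset.mem_range.2 hj),
      mul_assoc, ← mul_inv]
    congr 3
    exact Finset.prod_congr rfl fun k hk => by rw [hgy k (Finset.ne_of_mem_erase hk)]
  have hind : AlgebraicIndependent κ fun k => ρ (g' k) := by
    have h : (fun k => ρ (g' k)) = Function.update (fun k => ρ (g k)) j (ρ (g j * u)) := by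
      ext k
      rcases eq_or_ne k j with rfl | hk
      · rw [hg'j, Function.update_self]
      · rw [hg' k hk, Function.update_of_ne hk]
    rw [h]
    refine hg.update j fun h => ?_
    let S := Algebra.adjoin κ ((fun k => ρ (g k)) '' {j}ᶜ)
    have hmem : ∏ k ∈ (Finset.range i).erase j, ρ (g k) ^ 2 ∈ S := prod_mem fun k hk =>
      pow_mem (Algebra.subset_adjoin (Set.mem_image_of_mem (fun k => ρ (g k))
        (Finset.ne_of_mem_erase hk))) 2
    have halg := h.mul (isAlgebraic_algebraMap (A := F) (⟨_, hmem⟩ : S))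
    rw [map_mul, hρu] at halg
    convert halg using 1
    rw [mul_assoc]
    refine (mul_one _).symm.trans ?_
    congr 1
    exact (inv_mul_cancel₀ (Finset.prod_ne_zero_iff.2 fun k _ => pow_ne_zero 2
      (hg.ne_zero k))).symm
  have hA : R x i = Algebra.adjoin V (insert (ψ θ) (Set.range fun k : Set.Iio i => ψ (g' k))) := by
    rw [R_eq_adjoin_range, hψθ]
    congr 1
    ext z
    constructor
    · rintro (rfl | ⟨k, rfl⟩)
      · exact .inr ⟨⟨j, hj⟩, hψ⟩
      · rcases eq_or_ne (k : ℕ) j with hk | hk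
        · exact .inl (by simp only [hk])
        · exact .inr ⟨k, by simp only [hg' k hk, hgy k hk]⟩
    · rintro (rfl | ⟨k, rfl⟩)
      · exact .inr ⟨⟨j, hj⟩, rfl⟩
      · rcases eq_or_ne (k : ℕ) j with hk | hk
        · exact .inl (by simp only [hk, hψ])
        · exact .inr ⟨k, by simp only [hg' k hk, hgy k hk]⟩
  have hx := algebraMap_eq_gen_mul x (some j) i
  simp only [gen, Option.elim, if_pos hj] at hx
  refine ⟨?_, ?_, fun f hf => ?_⟩
  · rw [hA, Algebra.adjoin_le_iff]
    rintro _ (rfl | ⟨i, rfl⟩) <;> exact ⟨_, rfl⟩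
  · rw [← hψθ]
    exact inv_notMem_range ψ ρ hunit hρθ (hψθ ▸ y_ne_zero j)
  · have h := eq_mul_or_inv_mem_range ψ ρ q hq hρ hunit hρθ (g := fun k : Set.Iio i => g' k)
      (hind.comp _ Subtype.val_injective) hA (hψθ ▸ hx) hf
    rwa [hψθ] at h

end Local

/-- The finite injection from the Gauss ring will carry N-2 to the valuation ring. Surjectivity at
`none` identifies the Gauss ring with a discrete valuation ring, which shows that it is Noetherian.
-/
theorem exists_isPlace [IsDiscreteValuationRing V] {x : V} (hx : Irreducible x) (b : Option ℕ) :
    ∃ O, IsPlace x b O ∧ ∃ f : Gauss V →+* O, f.Finite ∧ Function.Injective f ∧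
      (b = none → Function.Surjective f) := by
  let κ := IsLocalRing.ResidueField V
  let F := FractionRing (MvPolynomial ℕ κ)
  have hq : ∀ a, IsLocalRing.residue V a = 0 ↔ x ∣ a := fun a => by
    rw [IsLocalRing.residue_eq_zero_iff, hx.maximalIdeal_eq, Ideal.mem_span_singleton]
  obtain ⟨ρ, hρ, hunit⟩ := exists_gauss_residue V
  let X : ℕ → Gauss V := fun k => algebraMap _ _ (MvPolynomial.X k : MvPolynomial ℕ V)
  have hρX : ∀ k, ρ (X k) = algebraMap (MvPolynomial ℕ κ) F (MvPolynomial.X k) := fun k => by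
    rw [hρ, MvPolynomial.map_X]
  have hX : AlgebraicIndependent κ fun k => ρ (X k) := by
    simp only [hρX]
    exact (MvPolynomial.algebraicIndependent_X ℕ κ).map'
      (f := IsScalarTower.toAlgHom κ (MvPolynomial ℕ κ) F) (IsFractionRing.injective _ _)
  have hρV : ∀ a, ρ (algebraMap V (Gauss V) a) = algebraMap κ F (IsLocalRing.residue V a) := by
    intro a
    rw [IsScalarTower.algebraMap_apply V (MvPolynomial ℕ V), hρ, MvPolynomial.algebraMap_eq,
      MvPolynomial.map_C, IsScalarTower.algebraMap_apply κ (MvPolynomial ℕ κ) F,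
      MvPolynomial.algebraMap_eq]
  cases b with
  | none =>
    obtain ⟨ψ, hψ, hinj⟩ := exists_gauss_algHom
      (IsScalarTower.toAlgHom V (MvPolynomial ℕ V) (Amb V)) (IsFractionRing.injective _ _)
    have h := fun i => place_xs ψ ρ _ hq hρV hunit hX (i := i) (fun k _ => hψ _) hx.ne_zero
    refine ⟨ψ.range, ⟨fun i => (h i).1, fun k _ => ?_, fun i => (h i).2.1, fun i => (h i).2.2⟩,
      ψ.rangeRestrict.toRingHom, .of_surjective _ ψ.rangeRestrict_surjective,
      fun a b hab => hinj (congrArg Subtype.val hab), fun _ => ψ.rangeRestrict_surjective⟩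
    obtain ⟨u, -, hu⟩ := exists_inv_lift ψ ρ hunit (hX.ne_zero k)
    exact ⟨u, hu.trans (congrArg _ (hψ _))⟩
  | some j =>
    obtain ⟨ψ, hψ, hinj⟩ := exists_gauss_algHom _ (algebraicIndependent_update_y hx.ne_zero j)
    have hψX : ∀ k, ψ (X k) =
        Function.update (y V) j (algebraMap V (Amb V) x * (y V j ^ 2)⁻¹) k := fun k => by
      rw [hψ, MvPolynomial.aeval_X]
    obtain ⟨u, hρu, hψu⟩ := exists_inv_lift ψ ρ hunit (hX.ne_zero j)
    have hx' : algebraMap V (Amb V) x ≠ 0 :=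
      (map_ne_zero_iff _ algebraMap_injective_amb).2 hx.ne_zero
    -- `u` is the inverse of the coordinate sent to `x / yⱼ²`, so `ψ (x * u) = yⱼ²`, with `x * u` of
    -- residue `0`.
    obtain ⟨G, _, _, ι, ψ', ρ', θ, hι, hψ', hρ', hρθ, hψθ, hunit'⟩ := exists_sqrt_extension ψ ρ hunit
      (c := algebraMap V (Gauss V) x * u) (z := y V j)
      (by rw [map_mul, hρV, (hq x).2 dvd_rfl, map_zero, zero_mul])
      (by
        have := y_ne_zero (V := V) j
        rw [map_mul, hψu, AlgHom.commutes, hψX, Function.update_self]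
        field_simp)
    have hρV' : ∀ a, ρ' (algebraMap V G a) = algebraMap κ F (IsLocalRing.residue V a) := fun a => by
      rw [← hρV, ← hρ', AlgHom.commutes]
    have hX' : AlgebraicIndependent κ fun k => ρ' (ι (X k)) := by simpa only [hρ'] using hX
    have hgy : ∀ k ≠ j, ψ' (ι (X k)) = y V k := fun k hk => by
      rw [hψ', hψX, Function.update_of_ne hk]
    have hgj : ψ' (ι (X j)) = algebraMap V (Amb V) x * (y V j ^ 2)⁻¹ := by
      rw [hψ', hψX, Function.update_self]
    have h : ∀ i, R x i ≤ ψ'.range ∧ (gen x (some j) i)⁻¹ ∉ ψ'.range ∧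
        ∀ f ∈ R x i, (∃ r ∈ R x i, f = gen x (some j) i * r) ∨ (f ≠ 0 ∧ f⁻¹ ∈ ψ'.range) := by
      intro i
      simp only [gen, Option.elim]
      split_ifs with hji
      · exact place_y ψ' ρ' _ hq hρV' hunit' hX' hji hgy hgj hρθ hψθ
      · exact place_xs ψ' ρ' _ hq hρV' hunit' hX' (fun k hk => hgy k (by omega)) hx.ne_zero
    refine ⟨ψ'.range, ⟨fun i => (h i).1, fun k hk => ?_, fun i => (h i).2.1, fun i => (h i).2.2⟩,
      ψ'.rangeRestrict.toRingHom.comp ι.toRingHom,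
      (RingHom.Finite.of_surjective _ ψ'.rangeRestrict_surjective).comp hι,
      fun a b hab => hinj ?_, by simp⟩
    · obtain ⟨u, -, hu⟩ := exists_inv_lift ψ' ρ' hunit' (hX'.ne_zero k)
      exact ⟨u, hu.trans (congrArg _ (hgy k fun h => hk (h ▸ rfl)))⟩
    · rw [← hψ', ← hψ']
      exact congrArg Subtype.val hab

end Places

end AlmostDedekindExample

/-! ### A criterion for discrete valuation rings in a field -/

section DVR

variable {V K : Type*} [CommRing V] [Field K] [Algebra V K]

/-- A subalgebra of a field is a discrete valuation ring with uniformizer `p` if every nonzero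
element of the field is a power of the nonunit `p` times a unit. -/
theorem Subalgebra.isDiscreteValuationRing_of_forall_eq_zpow_mul (O : Subalgebra V K) {p : K}
    (hp : p ∈ O) (hp0 : p ≠ 0) (hpinv : p⁻¹ ∉ O)
    (h : ∀ z ≠ 0, ∃ n : ℤ, ∃ u ∈ O, u ≠ 0 ∧ u⁻¹ ∈ O ∧ z = p ^ n * u) :
    IsDiscreteValuationRing O ∧ Irreducible (⟨p, hp⟩ : O) := by
  have hunit : ∀ u : O, (u : K) ≠ 0 → (u : K)⁻¹ ∈ O → IsUnit u := fun u h0 hu =>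
    IsUnit.of_mul_eq_one ⟨_, hu⟩ (Subtype.ext (mul_inv_cancel₀ h0))
  have hinv : ∀ u : O, IsUnit u → (u : K) ≠ 0 ∧ (u : K)⁻¹ ∈ O := by
    rintro _ ⟨w, rfl⟩
    have hw : ((w : O) : K) * ((↑w⁻¹ : O) : K) = 1 := congrArg Subtype.val w.mul_inv
    exact ⟨left_ne_zero_of_mul_eq_one hw, eq_inv_of_mul_eq_one_right hw ▸ (↑w⁻¹ : O).2⟩
  have hneg : ∀ n : ℕ, (p ^ (n + 1))⁻¹ ∉ O := fun n hn => hpinv <| by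
    have : p⁻¹ = (p ^ (n + 1))⁻¹ * p ^ n := by
      field_simp
      ring
    exact this ▸ mul_mem hn (pow_mem hp n)
  have hfac : ∀ z : O, z ≠ 0 → ∃ (n : ℕ) (u : O), IsUnit u ∧ z = ⟨p, hp⟩ ^ n * u := by
    intro z hz
    obtain ⟨n, u, hu, hu0, hu', hzu⟩ := h z fun h0 => hz (Subtype.ext h0)
    obtain ⟨n, rfl | rfl⟩ := n.eq_nat_or_neg
    · exact ⟨n, ⟨u, hu⟩, hunit _ hu0 hu', Subtype.ext (by simpa using hzu)⟩
    · cases n with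
      | zero => exact ⟨0, ⟨u, hu⟩, hunit _ hu0 hu', Subtype.ext (by simpa using hzu)⟩
      | succ n =>
        refine absurd ?_ (hneg n)
        have : (p ^ (n + 1))⁻¹ = z * u⁻¹ := by
          rw [hzu, zpow_neg, zpow_natCast, mul_inv_cancel_right₀ hu0]
        exact this ▸ mul_mem z.2 hu'
  have hpu : ¬ IsUnit (⟨p, hp⟩ : O) := fun hu => hpinv (hinv _ hu).2
  have hirr : Irreducible (⟨p, hp⟩ : O) := by
    refine ⟨hpu, fun a b hab => ?_⟩
    have hab0 : a * b ≠ 0 := hab ▸ fun h0 => hp0 (congrArg Subtype.val h0)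
    obtain ⟨n, u, hu, hau⟩ := hfac a (left_ne_zero_of_mul hab0)
    obtain ⟨m, w, hw, hbw⟩ := hfac b (right_ne_zero_of_mul hab0)
    rcases n with - | n
    · exact .inl (by simpa [hau] using hu)
    rcases m with - | m
    · exact .inr (by simpa [hbw] using hw)
    refine absurd ?_ hpu
    have hp0' : (⟨p, hp⟩ : O) ≠ 0 := fun h0 => hp0 (congrArg Subtype.val h0)
    refine IsUnit.of_mul_eq_one (⟨p, hp⟩ ^ (n + m) * (u * w)) (mul_left_cancel₀ hp0' ?_)
    rw [mul_one]
    refine Eq.trans ?_ hab.symm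
    rw [hau, hbw]
    ring
  refine ⟨IsDiscreteValuationRing.ofHasUnitMulPowIrreducibleFactorization
    ⟨⟨p, hp⟩, hirr, fun {z} hz => ?_⟩, hirr⟩
  obtain ⟨n, u, hu, rfl⟩ := hfac z hz
  exact ⟨n, hu.unit, rfl⟩

end DVR

/-! ### Valuation-theoretic consequences of `IsPlace` -/

namespace AlmostDedekindExample

section Formal

variable {V : Type u} [CommRing V] [IsDomain V] {x : V}

theorem xs_eq_xs_succ_mul (x : V) (i : ℕ) : xs x i = xs x (i + 1) * y V i ^ 2 := by
  rw [xs, div_mul_cancel₀ _ (pow_ne_zero 2 (y_ne_zero i))]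

theorem R_mono (x : V) : Monotone (R x) := by
  refine monotone_nat_of_le_succ fun i => ?_
  rw [R, Algebra.adjoin_le_iff]
  rintro _ (rfl | ⟨k, hk, rfl⟩)
  · rw [xs_eq_xs_succ_mul]
    exact mul_mem (xs_mem_R x _) (pow_mem (y_mem_R x i.lt_succ_self) 2)
  · exact y_mem_R x (Nat.lt_succ_of_lt hk)

theorem exists_mem_R (x : V) (p : MvPolynomial ℕ V) : ∃ i, algebraMap _ (Amb V) p ∈ R x i := by
  induction p using MvPolynomial.induction_on with
  | C a =>
    refine ⟨0, ?_⟩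
    rw [← MvPolynomial.algebraMap_eq, ← IsScalarTower.algebraMap_apply]
    exact (R x 0).algebraMap_mem a
  | add p q hp hq =>
    obtain ⟨i, hi⟩ := hp
    obtain ⟨j, hj⟩ := hq
    exact ⟨max i j, map_add (algebraMap _ (Amb V)) p q ▸ add_mem (R_mono x (le_max_left i j) hi)
      (R_mono x (le_max_right i j) hj)⟩
  | mul_X p n hp =>
    obtain ⟨i, hi⟩ := hp
    exact ⟨max i (n + 1), map_mul (algebraMap _ (Amb V)) p _ ▸ mul_mem
      (R_mono x (le_max_left _ _) hi) (R_mono x (le_max_right _ _) (y_mem_R x n.lt_succ_self))⟩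

theorem exists_eq_div (x : V) (z : Amb V) (k : ℕ) :
    ∃ i ≥ k, ∃ a ∈ R x i, ∃ b ∈ R x i, b ≠ 0 ∧ z = a / b := by
  obtain ⟨p, q, hq, rfl⟩ := IsFractionRing.div_surjective (A := MvPolynomial ℕ V) z
  obtain ⟨i, hi⟩ := exists_mem_R x p
  obtain ⟨j, hj⟩ := exists_mem_R x q
  exact ⟨max k (max i j), le_max_left _ _, _, R_mono x (by simp) hi, _, R_mono x (by simp) hj,
    IsFractionRing.to_map_ne_zero_of_mem_nonZeroDivisors hq, rfl⟩

theorem isNoetherianRing_R [IsNoetherianRing V] (x : V) (i : ℕ) : IsNoetherianRing (R x i) := by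
  have hfg : (R x i).FG :=
    Subalgebra.fg_def.2 ⟨_, ((Set.finite_Iio i).image _).insert _, rfl⟩
  have := (R x i).fg_iff_finiteType.1 hfg
  exact Algebra.FiniteType.isNoetherianRing V _

namespace IsPlace

variable {b : Option ℕ} {O : Subalgebra V (Amb V)}

/-- In the Noetherian domain `Rᵢ` a largest power of the nonunit generator can be split off; the
cofactor is not divisible by it, hence is a unit at the place. -/
theorem exists_eq_pow_mul [IsNoetherianRing V] (hO : IsPlace x b O) {i : ℕ} {f : Amb V}
    (hf : f ∈ R x i) (hf0 : f ≠ 0) :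
    ∃ n : ℕ, ∃ s ∈ R x i, s ≠ 0 ∧ s⁻¹ ∈ O ∧ f = gen x b i ^ n * s := by
  have := isNoetherianRing_R x i
  have hgen : ¬ IsUnit (⟨gen x b i, gen_mem_R x b i⟩ : R x i) := fun h => by
    obtain ⟨w, hw⟩ := h.exists_right_inv
    have hw' : gen x b i * w = 1 := congrArg Subtype.val hw
    exact hO.gen_inv_notMem i (eq_inv_of_mul_eq_one_right hw' ▸ hO.R_le i w.2)
  obtain ⟨n, s, hs, hfs⟩ := WfDvdMonoid.max_power_factor'
    (a₀ := (⟨f, hf⟩ : R x i)) (fun h => hf0 (congrArg Subtype.val h)) hgen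
  rcases hO.eq_mul_or_inv_mem i s s.2 with ⟨r, hr, h⟩ | h
  · exact absurd ⟨⟨r, hr⟩, Subtype.ext h⟩ hs
  · exact ⟨n, s, s.2, h.1, h.2, congrArg Subtype.val hfs⟩

theorem not_and_inv_mem_of_eq_gen_mul (hO : IsPlace x b O) {i : ℕ} {r : Amb V} (hr : r ∈ O) :
    ¬ (gen x b i * r ≠ 0 ∧ (gen x b i * r)⁻¹ ∈ O) := by
  rintro ⟨h0, h⟩
  refine hO.gen_inv_notMem i ?_
  have : (gen x b i)⁻¹ = (gen x b i * r)⁻¹ * r := by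
    rw [mul_inv, inv_mul_cancel_right₀ (right_ne_zero_of_mul h0)]
  exact this ▸ mul_mem h hr

/-- From some index on, the generators of the center of a place differ by units. -/
theorem exists_gen_eq_mul (hO : IsPlace x b O) : ∀ i ≥ b.elim 0 (· + 1),
    ∃ u ∈ O, u ≠ 0 ∧ u⁻¹ ∈ O ∧ gen x b i = gen x b (b.elim 0 (· + 1)) * u := by
  cases b with
  | none =>
    have hy : ∀ k, y V k ∈ O := fun k => hO.R_le (k + 1) (y_mem_R x k.lt_succ_self)
    refine fun i _ => ⟨(∏ k ∈ Finset.range i, y V k ^ 2)⁻¹, ?_, ?_, ?_, xs_eq x i⟩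
    · rw [← Finset.prod_inv_distrib]
      exact prod_mem fun k _ => inv_pow (y V k) 2 ▸ pow_mem (hO.y_inv_mem k (by simp)) 2
    · exact inv_ne_zero (Finset.prod_ne_zero_iff.2 fun k _ => pow_ne_zero 2 (y_ne_zero k))
    · rw [inv_inv]
      exact prod_mem fun k _ => pow_mem (hy k) 2
  | some j =>
    refine fun i hi => ⟨1, one_mem _, one_ne_zero, (inv_one (G := Amb V)).symm ▸ one_mem O, ?_⟩
    simp only [Option.elim, ge_iff_le] at hi
    simp [gen, show j < i by omega]

/-- Every element of the field is a fraction over some late `Rᵢ`, whose numerator and denominator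
are powers of the generator times units. The starting index is the first one at which the generator
is final up to units: `0` for `none`, and `j + 1` for `some j`, because `yⱼ` enters at `Rⱼ₊₁`. -/
theorem isDiscreteValuationRing_and_irreducible [IsNoetherianRing V] (hO : IsPlace x b O)
    (hx : x ≠ 0) : IsDiscreteValuationRing O ∧ Irreducible
      (⟨gen x b (b.elim 0 (· + 1)), hO.R_le _ (gen_mem_R x b _)⟩ : O) := by
  set i₀ := b.elim 0 (· + 1) with hi₀
  refine O.isDiscreteValuationRing_of_forall_eq_zpow_mul (hO.R_le i₀ (gen_mem_R x b i₀))
    (gen_ne_zero hx b i₀) (hO.gen_inv_notMem i₀) fun z hz => ?_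
  obtain ⟨i, hi, f, hf, g, hg, hg0, rfl⟩ := exists_eq_div x z i₀
  obtain ⟨n, s, hs, hs0, hs', rfl⟩ := hO.exists_eq_pow_mul hf (left_ne_zero_of_mul hz)
  obtain ⟨m, t, ht, ht0, ht', rfl⟩ := hO.exists_eq_pow_mul hg hg0
  obtain ⟨u, hu, hu0, hu', h⟩ := hO.exists_gen_eq_mul i hi
  refine ⟨n - m, u ^ n * u⁻¹ ^ m * (s * t⁻¹), mul_mem (mul_mem (pow_mem hu _) (pow_mem hu' _))
    (mul_mem (hO.R_le i hs) ht'), by positivity, ?_, ?_⟩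
  · rw [mul_inv, mul_inv, mul_inv, ← inv_pow, ← inv_pow, inv_inv, inv_inv]
    exact mul_mem (mul_mem (pow_mem hu' _) (pow_mem hu _)) (mul_mem hs' (hO.R_le i ht))
  · have := gen_ne_zero hx b i₀
    rw [h, ← hi₀, zpow_sub₀ this, zpow_natCast, zpow_natCast, mul_pow, mul_pow, inv_pow]
    field_simp

theorem isDiscreteValuationRing [IsNoetherianRing V] (hO : IsPlace x b O) (hx : x ≠ 0) :
    IsDiscreteValuationRing O :=
  (hO.isDiscreteValuationRing_and_irreducible hx).1

/-- If the denominator had the larger power of the generator, the inverse of the generator would lie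
in `O`. The result exhibits `O` as a localization of any ring between the union of the `Rᵢ` and `O`.
-/
theorem exists_eq_div_of_mem [IsNoetherianRing V] (hO : IsPlace x b O) (hx : x ≠ 0) {z : Amb V}
    (hz : z ∈ O) :
    ∃ i, ∃ r ∈ R x i, ∃ s ∈ R x i, s ≠ 0 ∧ s⁻¹ ∈ O ∧ z = r / s := by
  rcases eq_or_ne z 0 with rfl | hz0
  · exact ⟨0, 0, zero_mem _, 1, one_mem _, one_ne_zero, (inv_one (G := Amb V)).symm ▸ one_mem O, by simp⟩
  obtain ⟨i, -, f, hf, g, hg, hg0, rfl⟩ := exists_eq_div x z 0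
  obtain ⟨n, s, hs, hs0, hs', rfl⟩ := hO.exists_eq_pow_mul hf (left_ne_zero_of_mul hz0)
  obtain ⟨m, t, ht, ht0, ht', rfl⟩ := hO.exists_eq_pow_mul hg hg0
  have hgen := gen_ne_zero hx b i
  rcases le_or_gt m n with hmn | hmn
  · obtain ⟨k, rfl⟩ := Nat.exists_eq_add_of_le hmn
    refine ⟨i, gen x b i ^ k * s, mul_mem (pow_mem (gen_mem_R x b i) k) hs, t, ht, ht0, ht', ?_⟩
    field_simp
    ring
  · obtain ⟨k, rfl⟩ := Nat.exists_eq_add_of_lt hmn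
    refine absurd ?_ (hO.gen_inv_notMem i)
    have : (gen x b i)⁻¹ = gen x b i ^ n * s / (gen x b i ^ (n + k + 1) * t) *
        (gen x b i ^ k * t * s⁻¹) := by
      field_simp
      ring
    rw [this]
    exact mul_mem hz (mul_mem (mul_mem (pow_mem (hO.R_le i (gen_mem_R x b i)) k) (hO.R_le i ht)) hs')

/-- The center of a place on a subring of its valuation ring. -/
theorem exists_center [IsNoetherianRing V] (hO : IsPlace x b O) (hx : x ≠ 0)
    {A : Subalgebra V (Amb V)} (hA : A ≤ O) :
    ∃ I : Ideal A, I.IsPrime ∧ ∀ a : A, a ∉ I ↔ (a : Amb V) ≠ 0 ∧ (a : Amb V)⁻¹ ∈ O := by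
  have := hO.isDiscreteValuationRing hx
  refine ⟨(IsLocalRing.maximalIdeal O).comap (Subalgebra.inclusion hA), inferInstance, fun a => ?_⟩
  rw [Ideal.mem_comap, IsLocalRing.notMem_maximalIdeal]
  constructor
  · intro h
    obtain ⟨w, hw⟩ := h.exists_right_inv
    have hw' : (a : Amb V) * w = 1 := congrArg Subtype.val hw
    exact ⟨left_ne_zero_of_mul_eq_one hw', eq_inv_of_mul_eq_one_right hw' ▸ w.2⟩
  · rintro ⟨h0, h⟩
    exact IsUnit.of_mul_eq_one ⟨_, h⟩ (Subtype.ext (mul_inv_cancel₀ h0))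

end IsPlace

end Formal

end AlmostDedekindExample

/-! ### Finite extensions of N-2 domains, and prime avoidance -/

section FiniteExtension

/-- A domain that is a finite extension of an N-2 domain is N-2. -/
theorem IsN2.of_finite_of_injective {A B : Type u} [CommRing A] [IsDomain A] [CommRing B]
    [IsDomain B] (hA : IsN2 A) (f : A →+* B) (hfin : f.Finite) (hinj : Function.Injective f) :
    IsN2 B := by
  intro L _ _ _ _ _
  algebraize [f]
  let _ : Algebra A L := Algebra.compHom L f
  have : IsScalarTower A B L := .of_algebraMap_eq fun _ => rfl
  have : FaithfulSMul A L := (faithfulSMul_iff_algebraMap_injective _ _).2 <| by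
    rw [IsScalarTower.algebraMap_eq A B L, IsScalarTower.algebraMap_eq B (FractionRing B) L]
    exact ((algebraMap (FractionRing B) L).injective.comp (IsFractionRing.injective B _)).comp hinj
  let _ : Algebra (FractionRing A) L := FractionRing.liftAlgebra A L
  have : IsScalarTower A (FractionRing A) L := FractionRing.isScalarTower_liftAlgebra A L
  have : Algebra.EssFiniteType B (FractionRing B) :=
    Algebra.EssFiniteType.of_isLocalization _ (nonZeroDivisors B)
  have : Algebra.EssFiniteType B L := Algebra.EssFiniteType.comp B (FractionRing B) L
  have : Algebra.EssFiniteType A L := Algebra.EssFiniteType.comp A B L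
  have : Algebra.EssFiniteType (FractionRing A) L := Algebra.EssFiniteType.of_comp A _ L
  have : Algebra.IsAlgebraic B L :=
    (IsFractionRing.comap_isAlgebraic_iff (K := FractionRing B)).2 inferInstance
  have : Algebra.IsAlgebraic A L := Algebra.IsAlgebraic.trans A B L
  have : Algebra.IsAlgebraic (FractionRing A) L :=
    Algebra.IsAlgebraic.extendScalars (R := A) (IsFractionRing.injective A (FractionRing A))
  have : FiniteDimensional (FractionRing A) L := Algebra.finite_of_essFiniteType_of_isAlgebraic
  have hfinite := hA L
  let g : integralClosure A L →ₗ[A] integralClosure B L :=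
    { toFun := fun c => ⟨c, IsIntegral.tower_top c.2⟩
      map_add' := fun _ _ => rfl
      map_smul' := fun a c => Subtype.ext (IsScalarTower.algebraMap_smul B a (c : L)).symm }
  have : Module.Finite A (integralClosure B L) :=
    Module.Finite.of_surjective g fun c => ⟨⟨c, isIntegral_trans (R := A) _ c.2⟩, rfl⟩
  exact Module.Finite.of_restrictScalars_finite A B _

end FiniteExtension

/-- Prime avoidance on a subring. -/
theorem Subalgebra.exists_forall_mem_of_forall_exists {R K β : Type*} [CommRing R] [CommRing K]
    [Algebra R K] {A B : Subalgebra R K} (hAB : A ≤ B) (s : Finset β) (I : β → Ideal B)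
    (hI : ∀ b, (I b).IsPrime) (m : Ideal B)
    (h : ∀ r : B, (r : K) ∈ A → r ∈ m → ∃ b ∈ s, r ∈ I b) :
    ∃ b, ∀ r : B, (r : K) ∈ A → r ∈ m → r ∈ I b := by
  let ι := Subalgebra.inclusion hAB
  obtain ⟨a, -, -⟩ := h 0 (zero_mem A) (zero_mem m)
  -- The two arguments `a a` are the indices exempted from primality; no exemption is needed, so any
  -- index serves.
  obtain ⟨b, -, hb⟩ := (Ideal.subset_union_prime (I := m.comap ι) (f := fun b => (I b).comap ι)
    (s := s) a a fun b _ _ _ => Ideal.comap_isPrime ι (I b)).1 fun f hf => by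
      simpa using h (ι f) f.2 hf
  exact ⟨b, fun r hr hrm => hb (x := ⟨r, hr⟩) hrm⟩

/-! ### The maximal ideals of `D` and its localizations -/

namespace AlmostDedekindExample

section Structure

variable {V : Type u} [CommRing V] [IsDomain V] {x : V}
  {O : Option ℕ → Subalgebra V (Amb V)} (hO : ∀ b, IsPlace x b (O b))
include hO

/-- At each place, an element of `Rᵢ` not divisible by the generator of the center is a unit. In
this form the denominators are visibly multiplicative and increase with `i`. -/
theorem mem_denominators_iff {i : ℕ} {r : Amb V} :
    r ∈ denominators x i ↔ r ∈ R x i ∧ r ≠ 0 ∧ ∀ b, r⁻¹ ∈ O b := by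
  constructor
  · rintro ⟨hr, hxs, hy⟩
    have key : ∀ b, r ≠ 0 ∧ r⁻¹ ∈ O b := fun b => by
      refine ((hO b).eq_mul_or_inv_mem i r hr).resolve_left ?_
      rintro ⟨s, hs, h⟩
      cases b with
      | none => exact hxs s hs h
      | some j =>
        simp only [gen, Option.elim] at h
        split_ifs at h with hji
        exacts [hy j hji s hs h, hxs s hs h]
    exact ⟨hr, (key none).1, fun b => (key b).2⟩
  · rintro ⟨hr, hr0, h⟩
    refine ⟨hr, ?_, ?_⟩
    · rintro s hs rfl
      exact (hO none).not_and_inv_mem_of_eq_gen_mul ((hO none).R_le i hs) ⟨hr0, h none⟩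
    · rintro j hj s hs rfl
      have hgen : y V j = gen x (some j) i := by simp [gen, hj]
      rw [hgen] at h hr0
      exact (hO _).not_and_inv_mem_of_eq_gen_mul ((hO _).R_le i hs) ⟨hr0, h (some j)⟩

/-- On `Rᵢ` the places `some j` with `j ≥ i` have the same center as `none`, so only finitely many
places need testing. This makes prime avoidance available. -/
theorem mem_denominators_of_forall_lt {i : ℕ} {r : Amb V} (hr : r ∈ R x i)
    (h : ∀ b : Option ℕ, (∀ j, b = some j → j < i) → r ≠ 0 ∧ r⁻¹ ∈ O b) :
    r ∈ denominators x i := by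
  refine ⟨hr, ?_, ?_⟩
  · rintro s hs rfl
    exact (hO none).not_and_inv_mem_of_eq_gen_mul ((hO none).R_le i hs) (h none (by simp))
  · rintro j hj s hs rfl
    have hgen : y V j = gen x (some j) i := by simp [gen, hj]
    rw [hgen] at h
    exact (hO _).not_and_inv_mem_of_eq_gen_mul ((hO _).R_le i hs) (h (some j) (by simpa using hj))

omit hO in
theorem R_le_D (i : ℕ) : R x i ≤ D x := le_sup_left.trans (le_iSup (stage x) i)

omit hO in
theorem inv_mem_D {i : ℕ} {r : Amb V} (hr : r ∈ denominators x i) : r⁻¹ ∈ D x :=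
  (le_sup_right.trans (le_iSup (stage x) i)) (Algebra.subset_adjoin ⟨r, hr, rfl⟩)

theorem D_le (b : Option ℕ) : D x ≤ O b := by
  refine iSup_le fun i => sup_le ((hO b).R_le i) ?_
  rw [Algebra.adjoin_le_iff]
  rintro _ ⟨r, hr, rfl⟩
  exact ((mem_denominators_iff hO).1 hr).2.2 b

theorem denominators_mono : Monotone (denominators x) := fun i j hij r hr => by
  rw [mem_denominators_iff hO] at hr ⊢
  exact ⟨R_mono x hij hr.1, hr.2⟩

theorem denominators_mul {i : ℕ} {r s : Amb V} (hr : r ∈ denominators x i)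
    (hs : s ∈ denominators x i) : r * s ∈ denominators x i := by
  rw [mem_denominators_iff hO] at hr hs ⊢
  exact ⟨mul_mem hr.1 hs.1, mul_ne_zero hr.2.1 hs.2.1, fun b =>
    mul_inv r s ▸ mul_mem (hr.2.2 b) (hs.2.2 b)⟩

theorem one_mem_denominators (i : ℕ) : (1 : Amb V) ∈ denominators x i := by
  rw [mem_denominators_iff hO]
  exact ⟨one_mem _, one_ne_zero, fun b => (inv_one (G := Amb V)).symm ▸ one_mem (O b)⟩

theorem exists_eq_div_of_mem_D {d : Amb V} (hd : d ∈ D x) :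
    ∃ i, ∃ r ∈ R x i, ∃ s ∈ denominators x i, s ≠ 0 ∧ d = r / s := by
  let T : Subalgebra V (Amb V) :=
    { carrier := {d | ∃ i, ∃ r ∈ R x i, ∃ s ∈ denominators x i, s ≠ 0 ∧ d = r / s}
      mul_mem' := by
        rintro _ _ ⟨i, r, hr, s, hs, hs0, rfl⟩ ⟨j, r', hr', s', hs', hs0', rfl⟩
        exact ⟨max i j, r * r', mul_mem (R_mono x (le_max_left _ _) hr)
          (R_mono x (le_max_right _ _) hr'), s * s',
          denominators_mul hO (denominators_mono hO (le_max_left _ _) hs)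
            (denominators_mono hO (le_max_right _ _) hs'), mul_ne_zero hs0 hs0',
          div_mul_div_comm _ _ _ _⟩
      add_mem' := by
        rintro _ _ ⟨i, r, hr, s, hs, hs0, rfl⟩ ⟨j, r', hr', s', hs', hs0', rfl⟩
        have hr := R_mono x (le_max_left i j) hr
        have hr' := R_mono x (le_max_right i j) hr'
        have hs := denominators_mono hO (le_max_left i j) hs
        have hs' := denominators_mono hO (le_max_right i j) hs'
        exact ⟨max i j, r * s' + s * r', add_mem (mul_mem hr hs'.1) (mul_mem hs.1 hr'), s * s',
          denominators_mul hO hs hs', mul_ne_zero hs0 hs0', div_add_div _ _ hs0 hs0'⟩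
      algebraMap_mem' := fun a => ⟨0, _, (R x 0).algebraMap_mem a, 1, one_mem_denominators hO 0,
        one_ne_zero, (div_one _).symm⟩ }
  have hT : D x ≤ T := by
    refine iSup_le fun i => sup_le (fun r hr => ⟨i, r, hr, 1, one_mem_denominators hO i,
      one_ne_zero, (div_one _).symm⟩) ?_
    rw [Algebra.adjoin_le_iff]
    rintro _ ⟨r, hr, rfl⟩
    exact ⟨i, 1, one_mem _, r, hr, ((mem_denominators_iff hO).1 hr).2.1, (one_div r).symm⟩
  exact hT hd

/-- Elements of `m ∩ Rᵢ` are not denominators, so prime avoidance puts `m ∩ Rᵢ` inside one center.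
If `yⱼ ∈ m`, that center must be the one of `some j` for `i > j`, since `yⱼ` is a unit at all other
places. If `m` contains no `yⱼ`, it lies in the center of `none`. -/
theorem exists_forall_notMem_iff [IsNoetherianRing V] (hx : x ≠ 0) (m : Ideal (D x))
    [hm : m.IsMaximal] :
    ∃ b, ∀ d : D x, d ∉ m ↔ (d : Amb V) ≠ 0 ∧ (d : Amb V)⁻¹ ∈ O b := by
  choose I hIprime hI using fun b => (hO b).exists_center hx (D_le hO b)
  suffices h : ∃ b, m ≤ I b by
    obtain ⟨b, hb⟩ := h
    exact ⟨b, hm.eq_of_le (hIprime b).ne_top hb ▸ hI b⟩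
  have hden : ∀ i, ∀ s : D x, (s : Amb V) ∈ denominators x i → s ∉ m := fun i s hs hsm =>
    hm.ne_top (m.eq_top_of_isUnit_mem hsm (IsUnit.of_mul_eq_one ⟨_, inv_mem_D hs⟩
      (Subtype.ext (mul_inv_cancel₀ ((mem_denominators_iff hO).1 hs).2.1))))
  have hfrac : ∀ d : D x, ∀ k, ∃ i ≥ k, ∃ r s : D x, (r : Amb V) ∈ R x i ∧ s * d = r ∧
      ∀ b, s ∉ I b := by
    intro d k
    obtain ⟨i, r, hr, s, hs, hs0, h⟩ := exists_eq_div_of_mem_D hO d.2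
    refine ⟨max k i, le_max_left _ _, ⟨r, R_le_D i hr⟩, ⟨s, R_le_D i hs.1⟩,
      R_mono x (le_max_right _ _) hr, Subtype.ext ?_, fun b => ?_⟩
    · rw [MulMemClass.coe_mul, h, mul_div_cancel₀ _ hs0]
    · exact (hI b _).2 ⟨hs0, ((mem_denominators_iff hO).1 hs).2.2 b⟩
  have hyD : ∀ j, y V j ∈ D x := fun j => R_le_D (j + 1) (y_mem_R x j.lt_succ_self)
  have hcover : ∀ i, ∃ b, ∀ r : D x, (r : Amb V) ∈ R x i → r ∈ m → r ∈ I b := by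
    intro i
    let B : Finset (Option ℕ) := insert none ((Finset.range i).image some)
    have hB : ∀ b : Option ℕ, (∀ j, b = some j → j < i) → b ∈ B := by
      rintro (- | k) hk
      · simp [B]
      · simpa [B] using hk k rfl
    refine Subalgebra.exists_forall_mem_of_forall_exists (R_le_D i) B I hIprime m fun f hf hfm => ?_
    by_contra! hcon
    exact hden i f (mem_denominators_of_forall_lt hO hf fun b hb =>
      (hI b f).1 (hcon b (hB b hb))) hfm
  by_cases hym : ∃ j, (⟨y V j, hyD j⟩ : D x) ∈ m
  · obtain ⟨j, hj⟩ := hym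
    refine ⟨some j, fun d hd => ?_⟩
    obtain ⟨i, hi, r, s, hr, hrs, hs⟩ := hfrac d (j + 1)
    obtain ⟨b, hb⟩ := hcover i
    have hbj : b = some j := by
      by_contra hbj
      have hyI : (⟨y V j, hyD j⟩ : D x) ∈ I b := hb _ (y_mem_R x hi) hj
      exact (hI b _).2 ⟨y_ne_zero j, (hO b).y_inv_mem j hbj⟩ hyI
    subst hbj
    have hrI : r ∈ I (some j) := hb r hr (hrs ▸ m.mul_mem_left _ hd)
    exact ((hIprime _).mem_or_mem (hrs ▸ hrI)).resolve_left (hs _)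
  · rw [not_exists] at hym
    refine ⟨none, fun d hd => ?_⟩
    obtain ⟨i, -, r, s, hr, hrs, hs⟩ := hfrac d 0
    by_contra hdI
    have hrm : r ∈ m := hrs ▸ m.mul_mem_left _ hd
    have hrI : r ∉ I none := fun h =>
      ((hIprime _).mem_or_mem (hrs ▸ h)).elim (hs _) hdI
    -- Powers of `y₀, …, yᵢ₋₁` are stripped off one variable at a time; the cofactor stays in `m`
    -- because no `yₖ` is in `m`. At the end it is a denominator, hence a unit of `D`, a
    -- contradiction.
    have key : ∀ k ≤ i, ∃ f : D x, (f : Amb V) ∈ R x i ∧ f ∈ m ∧ f ∉ I none ∧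
        ∀ j < k, f ∉ I (some j) := by
      intro k hk
      induction k with
      | zero => exact ⟨r, hr, hrm, hrI, by simp⟩
      | succ k ih =>
        obtain ⟨f, hfR, hfm, hfI, hf⟩ := ih (by omega)
        obtain ⟨n, g, hg, hg0, hg', hfg⟩ := (hO (some k)).exists_eq_pow_mul hfR ((hI _ _).1 hfI).1
        have hfg' : f = ⟨y V k, hyD k⟩ ^ n * ⟨g, R_le_D i hg⟩ := by
          refine Subtype.ext (hfg.trans ?_)
          simp [gen, show k < i by omega]
        refine ⟨⟨g, R_le_D i hg⟩, hg, ?_, fun h => hfI (hfg' ▸ (I _).mul_mem_left _ h),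
          fun j hj => ?_⟩
        · exact (hm.isPrime.mem_or_mem (hfg' ▸ hfm)).resolve_left fun h =>
            hym k (hm.isPrime.mem_of_pow_mem n h)
        · rcases Nat.lt_succ_iff_lt_or_eq.1 hj with hj | rfl
          · exact fun h => hf j hj (hfg' ▸ (I _).mul_mem_left _ h)
          · exact (hI _ _).2 ⟨hg0, hg'⟩
    obtain ⟨f, hfR, hfm, hfI, hf⟩ := key i le_rfl
    refine hden i f (mem_denominators_of_forall_lt hO hfR fun b hb => (hI b f).1 ?_) hfm
    cases b with
    | none => exact hfI
    | some j => exact hf j (hb j rfl)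

theorem isLocalization_of_forall_notMem_iff [IsNoetherianRing V] (hx : x ≠ 0) {b : Option ℕ}
    (m : Ideal (D x)) [m.IsPrime]
    (hm : ∀ d : D x, d ∉ m ↔ (d : Amb V) ≠ 0 ∧ (d : Amb V)⁻¹ ∈ O b) :
    let _ : Algebra (D x) (O b) := (Subalgebra.inclusion (D_le hO b)).toAlgebra
    IsLocalization.AtPrime (O b) m := by
  intro _
  refine ⟨fun s => ?_, fun z => ?_, fun {a c} h => ⟨1, ?_⟩⟩
  · obtain ⟨h0, h⟩ := (hm s).1 s.2
    exact IsUnit.of_mul_eq_one ⟨_, h⟩ (Subtype.ext (mul_inv_cancel₀ h0))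
  · obtain ⟨i, r, hr, s, hs, hs0, hs', h⟩ := (hO b).exists_eq_div_of_mem hx z.2
    refine ⟨(⟨r, R_le_D i hr⟩, ⟨⟨s, R_le_D i hs⟩, (hm _).2 ⟨hs0, hs'⟩⟩), Subtype.ext ?_⟩
    change (z : Amb V) * s = r
    rw [h, div_mul_cancel₀ _ hs0]
  · have h' : (a : Amb V) = c := congrArg (Subtype.val : O b → Amb V) h
    rw [Subtype.ext h']

end Structure

end AlmostDedekindExample

/-! ### Eisenstein extensions `Tⁿ = p` of a discrete valuation ring -/

section Kummer

open Polynomial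

variable {O : Type u} {K : Type v} [CommRing O] [IsDomain O] [IsDiscreteValuationRing O] [Field K]
  [Algebra O K] [IsFractionRing O K] {p : O} {n : ℕ}

theorem isEisensteinAt_X_pow_sub_C (hp : Irreducible p) (hn : 0 < n) :
    (X ^ n - C p).IsEisensteinAt (Submodule.span O {p}) := by
  refine (monic_X_pow_sub_C p hn.ne').isEisensteinAt_of_mem_of_notMem
    (Ideal.span_singleton_ne_top hp.not_isUnit) (fun {i} hi => ?_) ?_
  · rw [natDegree_X_pow_sub_C] at hi
    rw [coeff_sub, coeff_X_pow, if_neg hi.ne, zero_sub, coeff_C]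
    split_ifs
    · exact neg_mem (Ideal.mem_span_singleton_self p)
    · simp
  · rw [coeff_sub, coeff_X_pow, if_neg hn.ne, zero_sub, coeff_C_zero, neg_mem_iff]
    change p ∉ Ideal.span {p} ^ 2
    rw [Ideal.span_singleton_pow, Ideal.mem_span_singleton]
    rintro ⟨c, hc⟩
    refine hp.not_isUnit (IsUnit.of_mul_eq_one c (mul_left_cancel₀ hp.ne_zero ?_))
    rw [mul_one]
    nth_rw 3 [hc]
    ring

theorem irreducible_X_pow_sub_C_of_irreducible (hp : Irreducible p) (hn : 0 < n) :
    Irreducible (X ^ n - C (algebraMap O K p)) := by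
  have h := (isEisensteinAt_X_pow_sub_C hp hn).irreducible
    ((Ideal.span_singleton_prime hp.ne_zero).2 hp.prime) (monic_X_pow_sub_C p hn.ne').isPrimitive
    (by rwa [natDegree_X_pow_sub_C])
  rw [(monic_X_pow_sub_C p hn.ne').irreducible_iff_irreducible_map_fraction_map (K := K)] at h
  simpa using h

/-- A common denominator of the coefficients of `z` is a unit times a power of `p`, and the
Eisenstein condition allows that power to be cancelled. -/
theorem PowerBasis.mem_adjoin_of_isIntegral_of_isEisensteinAt {L : Type*} [Field L] [Algebra K L]
    [Algebra O L] [IsScalarTower O K L] (B : PowerBasis K L) (hp : Irreducible p)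
    (hint : IsIntegral O B.gen) (hei : (minpoly O B.gen).IsEisensteinAt (Submodule.span O {p}))
    {z : L} (hz : IsIntegral O z) : z ∈ Algebra.adjoin O {B.gen} := by
  obtain ⟨q, hq⟩ := B.exists_eq_aeval' z
  obtain ⟨a, ha, hqa⟩ := IsLocalization.integerNormalization_spec (nonZeroDivisors O) q
  obtain ⟨m, w, hw⟩ := IsDiscreteValuationRing.associated_pow_irreducible
    (nonZeroDivisors.ne_zero ha) hp
  refine mem_adjoin_of_smul_prime_pow_smul_of_minpoly_isEisensteinAt (n := m) hp.prime hint hz ?_ hei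
  have haz : a • z = aeval B.gen (IsLocalization.integerNormalization (nonZeroDivisors O) q) := by
    rw [← aeval_map_algebraMap K, hqa, hq, ← algebraMap_smul K a q, map_smul, algebraMap_smul]
  rw [← hw, mul_comm, mul_smul, haz]
  exact Subalgebra.smul_mem _ (aeval_mem_adjoin_singleton _ _) _

/-- The integral elements of `K[T] / (Tⁿ - p)` have integral coefficients. -/
theorem exists_algebraMap_eq_coeff_of_isIntegral (hp : Irreducible p) (hn : 0 < n)
    {z : AdjoinRoot (X ^ n - C (algebraMap O K p))} (hz : IsIntegral O z) (k : ℕ) :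
    ∃ a : O, algebraMap O K a = (AdjoinRoot.modByMonicHom
      (monic_X_pow_sub_C (algebraMap O K p) hn.ne') z).coeff k := by
  set f := X ^ n - C (algebraMap O K p) with hf
  have hfmonic : f.Monic := monic_X_pow_sub_C _ hn.ne'
  have hfmap : (X ^ n - C p).map (algebraMap O K) = f := by simp [hf]
  have : Fact (Irreducible f) := ⟨irreducible_X_pow_sub_C_of_irreducible hp hn⟩
  let B := AdjoinRoot.powerBasis hfmonic.ne_zero
  have hB : B.gen = AdjoinRoot.root f := AdjoinRoot.powerBasis_gen _
  have hint : IsIntegral O B.gen := by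
    refine ⟨X ^ n - C p, monic_X_pow_sub_C p hn.ne', ?_⟩
    rw [hB, IsScalarTower.algebraMap_eq O K (AdjoinRoot f), ← eval₂_map, hfmap]
    exact AdjoinRoot.eval₂_root f
  have hmin : minpoly O B.gen = X ^ n - C p := by
    refine Polynomial.map_injective _ (IsFractionRing.injective O K) ?_
    rw [← minpoly.isIntegrallyClosed_eq_field_fractions' K hint, hfmap, hB,
      AdjoinRoot.minpoly_root hfmonic.ne_zero, hfmonic.leadingCoeff, inv_one, C_1, mul_one]
  have hei : (minpoly O B.gen).IsEisensteinAt (Submodule.span O {p}) :=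
    hmin ▸ isEisensteinAt_X_pow_sub_C hp hn
  have hz' := B.mem_adjoin_of_isIntegral_of_isEisensteinAt hp hint hei hz
  rw [hB, Algebra.adjoin_singleton_eq_range_aeval] at hz'
  obtain ⟨q, rfl⟩ := hz'
  -- Division by the monic polynomial can be done over `O` and commutes with the passage to `K`.
  refine ⟨(q %ₘ (X ^ n - C p)).coeff k, ?_⟩
  rw [← coeff_map, map_modByMonic _ (monic_X_pow_sub_C p hn.ne'), hfmap]
  change _ = (AdjoinRoot.modByMonicHom hfmonic (aeval (AdjoinRoot.root f) q)).coeff k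
  rw [← aeval_map_algebraMap K, AdjoinRoot.aeval_eq, AdjoinRoot.modByMonicHom_mk]

end Kummer

/-! ### Transfer of finiteness between rings and fraction fields -/

section FractionField

/-- The finiteness of integral closures in an N-2 domain does not depend on the model of the
fraction field. -/
theorem IsN2.finite_integralClosure {S K L : Type u} [CommRing S] [IsDomain S] (hS : IsN2 S)
    [Field K] [Algebra S K] [IsFractionRing S K] [Field L] [Algebra K L] [Algebra S L]
    [IsScalarTower S K L] [FiniteDimensional K L] : Module.Finite S (integralClosure S L) := by
  let e := FractionRing.algEquiv S K
  let _ : Algebra (FractionRing S) K := e.toRingHom.toAlgebra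
  let _ : Algebra (FractionRing S) L := ((algebraMap K L).comp e.toRingHom).toAlgebra
  have : IsScalarTower (FractionRing S) K L := .of_algebraMap_eq fun _ => rfl
  have : IsScalarTower S (FractionRing S) L := .of_algebraMap_eq fun s => by
    rw [IsScalarTower.algebraMap_apply S K L, ← e.commutes s]
    rfl
  have : Module.Finite (FractionRing S) K :=
    Module.Finite.of_surjective (Algebra.linearMap (FractionRing S) K) e.surjective
  have : FiniteDimensional (FractionRing S) L := Module.Finite.trans K L
  exact hS L

end FractionField

section AdjoinRoot

open Polynomial

/-- Divisibility by a monic polynomial descends along an injective map of coefficient rings. -/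
theorem AdjoinRoot.exists_injective_algHom {R K : Type*} [CommRing R] [CommRing K] [Algebra R K]
    (hRK : Function.Injective (algebraMap R K)) {f : R[X]} (hf : f.Monic) {g : K[X]}
    (hfg : f.map (algebraMap R K) = g) :
    ∃ j : AdjoinRoot f →ₐ[R] AdjoinRoot g, j (root f) = root g ∧ Function.Injective j := by
  have hroot : eval₂ (Algebra.ofId R (AdjoinRoot g) : R →+* AdjoinRoot g) (root g) f = 0 := by
    change aeval (root g) f = 0
    rw [← aeval_map_algebraMap K, hfg, AdjoinRoot.aeval_eq, mk_self]
  refine ⟨liftAlgHom f (Algebra.ofId R _) (root g) hroot, liftAlgHom_root _ _ _ _, ?_⟩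
  rw [injective_iff_map_eq_zero]
  intro z hz
  obtain ⟨q, rfl⟩ := mk_surjective z
  have hq : aeval (root g) q = 0 := by
    rw [liftAlgHom_mk] at hz
    exact hz
  rw [← aeval_map_algebraMap K, AdjoinRoot.aeval_eq, mk_eq_zero, ← hfg,
    map_dvd_map _ hRK hf] at hq
  exact mk_eq_zero.2 hq

theorem Subalgebra.isIntegral_of_le {R K L : Type*} [CommRing R] [CommRing K] [Algebra R K]
    [CommRing L] [Algebra K L] {A B : Subalgebra R K} (hAB : A ≤ B) {z : L} (hz : IsIntegral A z) :
    IsIntegral B z := by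
  let _ : Algebra A B := (Subalgebra.inclusion hAB).toAlgebra
  have : IsScalarTower A B L := .of_algebraMap_eq fun _ => rfl
  exact hz.tower_top

theorem IsIntegral.map_algHom {R A B : Type*} [CommRing R] [CommRing A] [CommRing B] [Algebra R A]
    [Algebra R B] {z : A} (hz : IsIntegral R z) (g : A →ₐ[R] B) : IsIntegral R (g z) :=
  hz.map g

/-- A common denominator for the coordinates `φ` of finitely many generators serves for the
coordinates of all integral elements. -/
theorem Subalgebra.exists_finset_of_finite_integralClosure {R K F : Type*} [CommRing R] [Field K]
    [Algebra R K] {A : Subalgebra R K} [CommRing F] [Algebra A F] (φ : F →ₗ[A] K)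
    (hfin : Module.Finite A (integralClosure A F)) :
    ∃ T : Finset K, (∀ t ∈ T, ∃ z, IsIntegral A z ∧ φ z = t) ∧
      ∀ s, (∀ t ∈ T, s * t ∈ A) → ∀ z, IsIntegral A z → s * φ z ∈ A := by
  classical
  obtain ⟨N, hN⟩ := hfin.fg_top
  refine ⟨N.image fun z : integralClosure A F => φ z, ?_, fun s hs z hz => ?_⟩
  · intro t ht
    obtain ⟨z, -, rfl⟩ := Finset.mem_image.1 ht
    exact ⟨z, z.2, rfl⟩
  · have key : ∀ z ∈ Submodule.span A (N : Set (integralClosure A F)), s * φ z ∈ A := by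
      intro z hz
      induction hz using Submodule.span_induction with
      | mem z hz => exact hs _ (Finset.mem_image.2 ⟨z, hz, rfl⟩)
      | zero => simp
      | add z w _ _ hz hw =>
        rw [Subalgebra.coe_add, map_add, mul_add]
        exact add_mem hz hw
      | smul d z _ hz =>
        rw [Subalgebra.coe_smul, map_smul, Algebra.smul_def, mul_left_comm]
        exact mul_mem d.2 hz
    exact key ⟨z, hz⟩ (hN ▸ Submodule.mem_top)

/-- If a finite extension `B` of `A` is N-1, then the integral closure of `A` in the fraction field
of `B` is finite. -/
theorem IsN1.finite_integralClosure {A B : Type u} [CommRing A] [CommRing B] [IsDomain B]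
    [Algebra A B] [Module.Finite A B] (hB : IsN1 B) :
    Module.Finite A (integralClosure A (FractionRing B)) := by
  have : Module.Finite B (integralClosure B (FractionRing B)) := hB
  have : Module.Finite A (integralClosure B (FractionRing B)) := Module.Finite.trans B _
  let g : integralClosure B (FractionRing B) →ₗ[A] integralClosure A (FractionRing B) :=
    { toFun := fun c => ⟨c, isIntegral_trans (R := A) _ c.2⟩
      map_add' := fun _ _ => rfl
      map_smul' := fun _ _ => rfl }
  exact Module.Finite.of_surjective g fun c => ⟨⟨c, IsIntegral.tower_top c.2⟩, rfl⟩

end AdjoinRoot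

/-! ### Failure of Noetherianity, N-2 and N-1 -/

namespace AlmostDedekindExample

open Polynomial

section FractionFields

variable {V : Type u} [CommRing V] [IsDomain V] {x : V}

theorem isFractionRing_of_forall_R_le {A : Subalgebra V (Amb V)} (hA : ∀ i, R x i ≤ A) :
    IsFractionRing A (Amb V) := by
  refine IsFractionRing.of_field _ _ fun z => ?_
  obtain ⟨i, -, a, ha, b, hb, -, h⟩ := exists_eq_div x z 0
  exact ⟨⟨a, hA i ha⟩, ⟨b, hA i hb⟩, h⟩

end FractionFields

section Kummer

variable {V : Type u} [CommRing V] [IsDomain V] [IsNoetherianRing V] {x : V} {n : ℕ}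

theorem exists_irreducible_algebraMap_eq {O : Subalgebra V (Amb V)} (hO : IsPlace x none O)
    (hx : x ≠ 0) : ∃ p : O, Irreducible p ∧ algebraMap O (Amb V) p = algebraMap V (Amb V) x :=
  ⟨_, (hO.isDiscreteValuationRing_and_irreducible hx).2, by simp [gen, xs]⟩

theorem irreducible_X_pow_sub_C {O : Subalgebra V (Amb V)} (hO : IsPlace x none O) (hx : x ≠ 0)
    (hn : 0 < n) : Irreducible (X ^ n - C (algebraMap V (Amb V) x)) := by
  obtain ⟨p, hp, hpx⟩ := exists_irreducible_algebraMap_eq hO hx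
  have := hO.isDiscreteValuationRing hx
  have := isFractionRing_of_forall_R_le hO.R_le
  rw [← hpx]
  exact irreducible_X_pow_sub_C_of_irreducible hp hn

theorem coeff_mem_of_isIntegral {O : Subalgebra V (Amb V)} (hO : IsPlace x none O) (hx : x ≠ 0)
    (hn : 0 < n) {f : (Amb V)[X]} (hf : f = X ^ n - C (algebraMap V (Amb V) x)) (hfm : f.Monic)
    {z : AdjoinRoot f} (hz : IsIntegral O z) (k : ℕ) :
    (AdjoinRoot.modByMonicHom hfm z).coeff k ∈ O := by
  obtain ⟨p, hp, hpx⟩ := exists_irreducible_algebraMap_eq hO hx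
  have := hO.isDiscreteValuationRing hx
  have := isFractionRing_of_forall_R_le hO.R_le
  rw [← hpx] at hf
  subst hf
  obtain ⟨a, ha⟩ := exists_algebraMap_eq_coeff_of_isIntegral (K := Amb V) hp hn hz k
  exact ha ▸ a.2

end Kummer

section Nonfinite

variable {V : Type u} [CommRing V] [IsDomain V] {x : V}
  {O : Option ℕ → Subalgebra V (Amb V)} (hO : ∀ b, IsPlace x b (O b))
include hO

/-- If the chain of ideals `(xᵢ)` stopped at `i`, then `yᵢ` would be a unit of `D`, but it is not
one at the place `some i`. -/
theorem not_isNoetherianRing_D (hx : x ≠ 0) : ¬ IsNoetherianRing (D x) := by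
  intro h
  have hdvd : ∀ i, (⟨xs x (i + 1), R_le_D _ (xs_mem_R x (i + 1))⟩ : D x) ∣
      ⟨xs x i, R_le_D _ (xs_mem_R x i)⟩ := fun i =>
    ⟨⟨y V i ^ 2, pow_mem (R_le_D (i + 1) (y_mem_R x i.lt_succ_self)) 2⟩,
      Subtype.ext (xs_eq_xs_succ_mul x i)⟩
  let c : ℕ →o Ideal (D x) :=
    ⟨fun i => Ideal.span {⟨xs x i, R_le_D _ (xs_mem_R x i)⟩}, monotone_nat_of_le_succ fun i =>
      Ideal.span_singleton_le_span_singleton.2 (hdvd i)⟩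
  obtain ⟨i, hi⟩ := monotone_stabilizes_iff_noetherian.2 h c
  have hle := (hi (i + 1) i.le_succ).ge
  obtain ⟨d, hd⟩ := Ideal.span_singleton_le_span_singleton.1 hle
  have hd' : xs x (i + 1) = xs x i * d := congrArg Subtype.val hd
  rw [xs_eq_xs_succ_mul x i, mul_assoc] at hd'
  have hunit : y V i ^ 2 * d = 1 := mul_left_cancel₀ (xs_ne_zero hx (i + 1)) (by
    rw [← hd', mul_one])
  have hgen : gen x (some i) (i + 1) = y V i := by simp [gen]
  refine (hO (some i)).gen_inv_notMem (i + 1) ?_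
  rw [hgen, inv_eq_of_mul_eq_one_right (b := y V i * d) (by rw [← hunit]; ring)]
  exact mul_mem ((hO _).R_le (i + 1) (y_mem_R x i.lt_succ_self)) (D_le hO _ d.2)

/-- The elements `1 / (y₀ ⋯ yᵢ₋₁)` have no common denominator in `D` that is a unit at the
place `none`. -/
theorem false_of_forall_mul_inv_mem_D {s : Amb V} (hs : s ∈ D x) (hs0 : s ≠ 0)
    (hs' : s⁻¹ ∈ O none) (h : ∀ i, s * (∏ k ∈ Finset.range i, y V k)⁻¹ ∈ D x) : False := by
  obtain ⟨i, r, hr, d, hd, hd0, rfl⟩ := exists_eq_div_of_mem_D hO hs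
  have hd' := (mem_denominators_iff hO).1 hd
  have hr0 : r ≠ 0 := left_ne_zero_of_mul hs0
  -- The variable `yᵢ` is the first one beyond the stage `Rᵢ` that contains the numerator `r`.
  have hyi : r * (y V i)⁻¹ ∈ O (some i) := by
    have hmem := D_le hO (some i) (h (i + 1))
    have hprod : ∏ k ∈ Finset.range i, y V k ∈ O (some i) := prod_mem fun k _ =>
      (hO _).R_le (k + 1) (y_mem_R x k.lt_succ_self)
    have hprod0 : ∏ k ∈ Finset.range i, y V k ≠ 0 :=
      Finset.prod_ne_zero_iff.2 fun k _ => y_ne_zero k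
    convert mul_mem (mul_mem hmem hprod) ((hO (some i)).R_le i hd'.1) using 1
    rw [Finset.prod_range_succ]
    field_simp
  -- At stage `i` the places `some i` and `none` still share the center `xᵢ`, so `r`, a unit at
  -- `none`, is a unit at `some i`.
  have hgen : gen x (some i) i = gen x none i := by simp [gen]
  rcases (hO (some i)).eq_mul_or_inv_mem i r hr with ⟨r', hr', h⟩ | ⟨-, h⟩
  · rw [hgen] at h
    refine (hO none).not_and_inv_mem_of_eq_gen_mul (i := i) ((hO none).R_le i hr') ?_
    rw [← h]
    refine ⟨hr0, ?_⟩
    convert mul_mem hs' (hd'.2.2 none) using 1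
    field_simp
  · refine (hO (some i)).gen_inv_notMem (i + 1) ?_
    convert mul_mem hyi h using 1
    have hgen' : gen x (some i) (i + 1) = y V i := by simp [gen]
    rw [hgen']
    field_simp

/-- Each element of the valuation ring of `none` has a denominator in some `Rᵢ` that is a unit at
`none`; these are multiplied together. -/
theorem exists_common_denominator [IsNoetherianRing V] (hx : x ≠ 0) (T : Finset (Amb V))
    (hT : ∀ z ∈ T, z ∈ O none) :
    ∃ s ∈ D x, s ≠ 0 ∧ s⁻¹ ∈ O none ∧ ∀ z ∈ T, s * z ∈ D x := by
  classical
  induction T using Finset.induction_on with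
  | empty => exact ⟨1, one_mem _, one_ne_zero, (inv_one (G := Amb V)).symm ▸ one_mem _, by simp⟩
  | insert a T _ ih =>
    obtain ⟨s, hs, hs0, hs', h⟩ := ih fun z hz => hT z (Finset.mem_insert_of_mem hz)
    obtain ⟨i, r, hr, d, hd, hd0, hd', rfl⟩ :=
      (hO none).exists_eq_div_of_mem hx (hT a (Finset.mem_insert_self _ _))
    have hdD := R_le_D i hd
    refine ⟨s * d, mul_mem hs hdD, mul_ne_zero hs0 hd0, mul_inv s d ▸ mul_mem hs' hd', ?_⟩
    intro z hz
    rcases Finset.mem_insert.1 hz with rfl | hz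
    · rw [mul_assoc, mul_div_cancel₀ _ hd0]
      exact mul_mem hs (R_le_D i hr)
    · rw [mul_right_comm]
      exact mul_mem (h z hz) hdD

/-- The linear form `c` reads off the coefficient of `tⁿ⁻¹`. Finiteness would give all its values on
integral elements coming from `F` one common denominator, yet it takes the values `1 / (y₀ ⋯ yᵢ₋₁)`
there. -/
theorem not_finite_integralClosure_of_linearMap [IsNoetherianRing V] (hx : x ≠ 0) {n : ℕ}
    (hn : 1 < n) {A : Subalgebra V (Amb V)} (hA : A = D x) {F L : Type*} [Field F] [Algebra A F]
    [Field L] [Algebra (Amb V) L] (g : F →ₐ[A] L) (t : F)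
    (ht : g t ^ n = algebraMap (Amb V) L (algebraMap V (Amb V) x)) (c : L →ₗ[Amb V] Amb V)
    (hct : c (g t ^ (n - 1)) = 1) (hc : ∀ z : L, IsIntegral A z → c z ∈ O none) :
    ¬ Module.Finite A (integralClosure A F) := by
  intro hfin
  have hn0 : 0 < n := by omega
  obtain ⟨T, hT, h⟩ := Subalgebra.exists_finset_of_finite_integralClosure
    ((c.restrictScalars A).comp g.toLinearMap) hfin
  obtain ⟨s, hs, hs0, hs', hsT⟩ := exists_common_denominator hO hx T fun z hz => by
    obtain ⟨w, hw, rfl⟩ := hT z hz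
    exact hc _ (hw.map_algHom g)
  rw [← hA] at hs hsT
  refine false_of_forall_mul_inv_mem_D hO (hA ▸ hs) hs0 hs' fun i => ?_
  rw [← hA]
  have hRA : R x i ≤ A := hA ▸ R_le_D i
  have hy0 : ∏ k ∈ Finset.range i, y V k ≠ 0 :=
    Finset.prod_ne_zero_iff.2 fun k _ => y_ne_zero k
  let X : A := ⟨xs x i, hRA (xs_mem_R x i)⟩
  let Y : A := ⟨∏ k ∈ Finset.range i, y V k,
    prod_mem fun k hk => hRA (y_mem_R x (Finset.mem_range.1 hk))⟩
  have hY : g (algebraMap A F Y) = algebraMap (Amb V) L (∏ k ∈ Finset.range i, y V k) := by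
    rw [g.commutes, IsScalarTower.algebraMap_apply A (Amb V) L]
    rfl
  have hY0 : algebraMap A F Y ≠ 0 := by
    intro h0
    rw [h0, map_zero, eq_comm, map_eq_zero] at hY
    exact hy0 hY
  have hXY : ((X * Y ^ 2 : A) : Amb V) = algebraMap V (Amb V) x := by
    change xs x i * (∏ k ∈ Finset.range i, y V k) ^ 2 = _
    rw [xs_eq, Finset.prod_pow, inv_mul_cancel_right₀ (pow_ne_zero 2 hy0)]
  have htn : t ^ n = algebraMap A F (X * Y ^ 2) := by
    refine (g : F →+* L).injective ?_
    change g (t ^ n) = g _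
    rw [map_pow, ht, g.commutes, IsScalarTower.algebraMap_apply A (Amb V) L, ← hXY]
    rfl
  have hint : IsIntegral A (t ^ (n - 1) * (algebraMap A F Y)⁻¹) := by
    refine IsIntegral.of_pow hn0 ?_
    obtain ⟨m, rfl⟩ := Nat.exists_eq_add_of_le' hn
    -- With `n = m + 2` and `tⁿ = X Y²`, the power is `(X Y²)ⁿ⁻¹ / Yⁿ = Xⁿ⁻¹ Yⁿ⁻²`; the square in
    -- `xᵢ = xᵢ₊₁ yᵢ²` makes the exponent of `Y` nonnegative.
    have hpow : (t ^ (m + 2 - 1) * (algebraMap A F Y)⁻¹) ^ (m + 2) =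
        algebraMap A F (X ^ (m + 1) * Y ^ m) := by
      rw [mul_pow, ← pow_mul, mul_comm _ (m + 2), pow_mul, htn]
      simp only [map_mul, map_pow, inv_pow]
      rw [mul_inv_eq_iff_eq_mul₀ (pow_ne_zero _ hY0), show m + 2 - 1 = m + 1 by omega]
      ring
    rw [hpow]
    exact isIntegral_algebraMap
  have hval : g (t ^ (n - 1) * (algebraMap A F Y)⁻¹) =
      (∏ k ∈ Finset.range i, y V k)⁻¹ • g t ^ (n - 1) := by
    rw [map_mul, map_pow, map_inv₀, hY, ← map_inv₀, Algebra.smul_def, mul_comm]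
  have hmem := h s hsT _ hint
  change s * c (g (t ^ (n - 1) * (algebraMap A F Y)⁻¹)) ∈ A at hmem
  rwa [hval, map_smul, hct, smul_eq_mul, mul_one] at hmem

/-- The field `F` is only mapped into the Kummer extension, so that the result applies both to that
extension itself and to the abstract fraction field of `D[T] / (Tⁿ - x)`. -/
theorem not_finite_integralClosure_of_algHom_adjoinRoot [IsNoetherianRing V] (hx : x ≠ 0) {n : ℕ}
    (hn : 1 < n) {f : (Amb V)[X]} (hf : f = X ^ n - C (algebraMap V (Amb V) x))
    {A : Subalgebra V (Amb V)} (hA : A = D x) {F : Type*} [Field F] [Algebra A F]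
    (g : F →ₐ[A] AdjoinRoot f) (t : F) (ht : g t = AdjoinRoot.root f) :
    ¬ Module.Finite A (integralClosure A F) := by
  have hn0 : 0 < n := by omega
  have hfmonic : f.Monic := hf ▸ monic_X_pow_sub_C _ hn0.ne'
  have : Fact (Irreducible f) := ⟨hf ▸ irreducible_X_pow_sub_C (hO none) hx hn0⟩
  refine not_finite_integralClosure_of_linearMap hO hx hn hA g t ?_
    ((lcoeff (Amb V) (n - 1)).comp (AdjoinRoot.modByMonicHom hfmonic)) ?_ fun z hz =>
    coeff_mem_of_isIntegral (hO none) hx hn0 hf hfmonic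
      (Subalgebra.isIntegral_of_le (hA ▸ D_le hO none) hz) (n - 1)
  · have h : aeval (AdjoinRoot.root f) (X ^ n - C (algebraMap V (Amb V) x)) = 0 := by
      rw [← hf, AdjoinRoot.aeval_eq, AdjoinRoot.mk_self]
    rwa [map_sub, map_pow, aeval_X, aeval_C, sub_eq_zero, ← ht] at h
  · change (AdjoinRoot.modByMonicHom hfmonic (g t ^ (n - 1))).coeff (n - 1) = 1
    rw [ht, ← AdjoinRoot.mk_X, ← map_pow, AdjoinRoot.modByMonicHom_mk,
      (modByMonic_eq_self_iff hfmonic).2, coeff_X_pow_self]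
    rw [degree_X_pow, hf, degree_X_pow_sub_C hn0]
    exact_mod_cast (by omega : n - 1 < n)

end Nonfinite

open Polynomial

variable {V : Type u} [CommRing V] [IsDomain V] [IsDiscreteValuationRing V] {x : V}

theorem isN2_gauss (hV : IsN2 V) (hx : Irreducible x) : IsN2 (Gauss V) := by
  have hle : (gaussIdeal V).primeCompl ≤ nonZeroDivisors (MvPolynomial ℕ V) :=
    (gaussIdeal V).primeCompl_le_nonZeroDivisors
  have : IsDomain (Gauss V) := IsLocalization.isDomain_localization hle
  obtain ⟨O, hO, f, -, hinj, hsurj⟩ := exists_isPlace hx none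
  have := hO.isDiscreteValuationRing hx.ne_zero
  have : IsNoetherianRing (Gauss V) :=
    isNoetherianRing_of_ringEquiv O (RingEquiv.ofBijective f ⟨hinj, hsurj rfl⟩).symm
  exact IsN2.of_isLocalization_mvPolynomial (σ := ℕ) hV (gaussIdeal V).primeCompl hle (Gauss V)

/-- The localization is the valuation ring of a place, hence finite over a Gauss ring and N-2. It
dominates `V` because `x` is a multiple of the generator of the center and so is not a unit there.
-/
theorem localization_properties (hV : IsN2 V) (hx : Irreducible x) (m : Ideal (D x))
    [m.IsMaximal] :
    IsDiscreteValuationRing (Localization.AtPrime m) ∧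
      IsUniversallyJapanese (Localization.AtPrime m) ∧
      Function.Injective (algebraMap V (Localization.AtPrime m)) ∧
      IsLocalHom (algebraMap V (Localization.AtPrime m)) := by
  choose O hO f hfin hinj hsurj using fun b => exists_isPlace hx b
  obtain ⟨b, hb⟩ := exists_forall_notMem_iff hO hx.ne_zero m
  let _ : Algebra (D x) (O b) := (Subalgebra.inclusion (D_le hO b)).toAlgebra
  have : IsLocalization.AtPrime (O b) m := isLocalization_of_forall_notMem_iff hO hx.ne_zero m hb
  let e : O b ≃+* Localization.AtPrime m :=
    (IsLocalization.algEquiv m.primeCompl (O b) (Localization.AtPrime m)).toRingEquiv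
  have := (hO b).isDiscreteValuationRing hx.ne_zero
  have : IsDomain (Localization.AtPrime m) :=
    IsLocalization.isDomain_localization m.primeCompl_le_nonZeroDivisors
  have hdvr : IsDiscreteValuationRing (Localization.AtPrime m) :=
    IsDiscreteValuationRing.RingEquivClass.isDiscreteValuationRing e
  have : IsDomain (Gauss V) :=
    IsLocalization.isDomain_localization (gaussIdeal V).primeCompl_le_nonZeroDivisors
  have hN2 : IsN2 (Localization.AtPrime m) :=
    (isN2_gauss hV hx).of_finite_of_injective (e.toRingHom.comp (f b))
      ((RingHom.Finite.of_surjective _ e.surjective).comp (hfin b)) (e.injective.comp (hinj b))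
  have hVm : ∀ a, algebraMap V (Localization.AtPrime m) a =
      algebraMap (D x) _ (algebraMap V (D x) a) := IsScalarTower.algebraMap_apply V (D x) _
  refine ⟨hdvr, hN2.isUniversallyJapanese, ?_, ⟨fun a ha => ?_⟩⟩
  · rw [IsScalarTower.algebraMap_eq V (D x) (Localization.AtPrime m),
      RingHom.coe_comp]
    refine (IsLocalization.injective (Localization.AtPrime m) m.primeCompl_le_nonZeroDivisors).comp fun a a' haa' => ?_
    exact algebraMap_injective_amb (congrArg Subtype.val haa')
  · by_contra hau
    have hxa : x ∣ a := by
      rw [← Ideal.mem_span_singleton, ← hx.maximalIdeal_eq]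
      exact hau
    have hxu := isUnit_of_dvd_unit (map_dvd (algebraMap V (Localization.AtPrime m)) hxa) ha
    rw [hVm, IsLocalization.AtPrime.isUnit_to_map_iff _ m] at hxu
    obtain ⟨r, hr, h⟩ := algebraMap_eq_gen_mul x b 0
    have hxb := (hb _).1 hxu
    refine (hO b).not_and_inv_mem_of_eq_gen_mul (i := 0) ((hO b).R_le 0 hr) ?_
    rw [← h]
    exact hxb

theorem not_isN2_D (hx : Irreducible x) : ¬ IsN2 (D x) := by
  intro h
  choose O hO _ _ _ _ using fun b => exists_isPlace hx b
  have := isFractionRing_of_forall_R_le (A := D x) (x := x) R_le_D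
  obtain ⟨f, hf⟩ : ∃ f : (Amb V)[X], f = X ^ 2 - C (algebraMap V (Amb V) x) := ⟨_, rfl⟩
  have : Fact (Irreducible f) :=
    ⟨hf ▸ irreducible_X_pow_sub_C (hO none) hx.ne_zero two_pos⟩
  have : FiniteDimensional (Amb V) (AdjoinRoot f) :=
    (hf ▸ monic_X_pow_sub_C _ two_ne_zero : f.Monic).finite_adjoinRoot
  exact not_finite_integralClosure_of_algHom_adjoinRoot hO hx.ne_zero one_lt_two hf rfl
    (AlgHom.id (D x) (AdjoinRoot f)) _ rfl
    (h.finite_integralClosure (K := Amb V) (L := AdjoinRoot f))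

theorem exists_isDomain_not_isN1 (hx : Irreducible x) {n : ℕ} (hn : 1 < n) :
    ∃ _ : IsDomain (AdjoinRoot (X ^ n - C (algebraMap V (D x) x))),
      ¬ IsN1 (AdjoinRoot (X ^ n - C (algebraMap V (D x) x))) := by
  choose O hO _ _ _ _ using fun b => exists_isPlace hx b
  obtain ⟨f, hf⟩ : ∃ f : (Amb V)[X], f = X ^ n - C (algebraMap V (Amb V) x) := ⟨_, rfl⟩
  obtain ⟨p, hp⟩ : ∃ p : (D x)[X], p = X ^ n - C (algebraMap V (D x) x) := ⟨_, rfl⟩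
  have hn0 : n ≠ 0 := by omega
  have hpm : p.Monic := hp ▸ monic_X_pow_sub_C _ hn0
  have hpf : p.map (algebraMap (D x) (Amb V)) = f := by
    rw [hp, hf, Polynomial.map_sub, Polynomial.map_pow, map_X, map_C,
      ← IsScalarTower.algebraMap_apply]
  have : Fact (Irreducible f) :=
    ⟨hf ▸ irreducible_X_pow_sub_C (hO none) hx.ne_zero (by omega)⟩
  obtain ⟨j, hj, hinj⟩ := AdjoinRoot.exists_injective_algHom Subtype.val_injective hpm hpf
  rw [← hp]
  have hdom : IsDomain (AdjoinRoot p) := hinj.isDomain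
  refine ⟨hdom, fun h => ?_⟩
  have : Module.Finite (D x) (AdjoinRoot p) := hpm.finite_adjoinRoot
  exact not_finite_integralClosure_of_algHom_adjoinRoot hO hx.ne_zero hn hf rfl
    (IsFractionRing.liftAlgHom (K := FractionRing (AdjoinRoot p)) hinj)
    (algebraMap _ _ (AdjoinRoot.root p)) ((IsFractionRing.lift_algebraMap hinj _).trans hj)
    h.finite_integralClosure

end AlmostDedekindExample

theorem mainTheorem11 (V : Type u) [CommRing V] [IsDomain V] [IsDiscreteValuationRing V]
    (hV : IsN2 V) (x : V) (hx : Irreducible x) :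
    Function.Injective (algebraMap V (AlmostDedekindExample.D x)) ∧
    ¬ IsNoetherianRing (AlmostDedekindExample.D x) ∧
    (∀ (m : Ideal (AlmostDedekindExample.D x)) [m.IsMaximal],
      IsDiscreteValuationRing (Localization.AtPrime m) ∧
      IsUniversallyJapanese (Localization.AtPrime m) ∧
      Function.Injective (algebraMap V (Localization.AtPrime m)) ∧
      IsLocalHom (algebraMap V (Localization.AtPrime m))) ∧
    ¬ IsN2 (AlmostDedekindExample.D x) ∧
    ∀ n : ℕ, 1 < n →
      ∃ _ : IsDomain (AdjoinRoot
          (Polynomial.X ^ n - Polynomial.C (algebraMap V (AlmostDedekindExample.D x) x))),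
        ¬ IsN1 (AdjoinRoot (Polynomial.X ^ n - Polynomial.C (algebraMap V (AlmostDedekindExample.D x) x))) := by
  choose O hO _ _ _ _ using fun b => AlmostDedekindExample.exists_isPlace hx b
  refine ⟨fun a a' h => AlmostDedekindExample.algebraMap_injective_amb (congrArg Subtype.val h),
    AlmostDedekindExample.not_isNoetherianRing_D hO hx.ne_zero, fun m _ =>
    AlmostDedekindExample.localization_properties hV hx m, AlmostDedekindExample.not_isN2_D hx,
    fun n hn => AlmostDedekindExample.exists_isDomain_not_isN1 hx hn⟩
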